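/- Let $p$ be a prime and let $G$ be a uniform pro-$p$ group: a pro-$p$ group which, for some $l\ge 0$, is topologically generated by $l$ elements and satisfies $G^{p^n}/G^{p^{n+1}}\cong(\mathbb{Z}/p\mathbb{Z})^l$ for all $n\ge 0$, where $G^{p^n}$ is the closed subgroup generated by the $p^n$-th powers. Put $G^{(n)}=G/G^{p^n}$ and $\Lambda=\mathbb{Z}_p[[G]]=\varprojlim_n\mathbb{Z}_p[G^{(n)}]$; modules are left modules. Let $X$ be a finite graph (loops and multiple edges allowed) with vertices $v_1,\dots,v_m$, choose a direction for every edge, and let $\alpha$ be a voltage assignment that attaches to every edge, in its chosen direction, an element of $G$; extend $\alpha$ to all directed edges by $\alpha(\bar e)=\alpha(e)^{-1}$ for the reversed edge $\bar e$ (a loop gives two directed edges). Let $X_n$ be the derived graph of $\alpha$ modulo $G^{p^n}$: its vertices are the pairs $(v,g)$, $v\in V(X)$, $g\in G^{(n)}$, and every edge $e$ of $X$ from $v$ to $w$ gives one edge from $(v,g)$ to $(w,g\alpha(e))$ for each $g$; $G^{(n)}$ acts by $h(v,g)=(v,hg)$. Let $\mathrm{Pic}(X_n)$ be the free $\mathbb{Z}_p$-module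 on the vertices of $X_n$ modulo the $\mathbb{Z}_p$-submodule generated by the divisors $\sum_{e\colon x\to y}(x-y)$, $x\in V(X_n)$, the sum over all directed edges $e$ starting at $x$, and let $\mathrm{Pic}_\infty=\varprojlim_n\mathrm{Pic}(X_n)$, a $\Lambda$-module. Let $D$ be the diagonal matrix over $\Lambda$ whose entry at $v_i$ is the number of directed edges starting at $v_i$ (a loop counts twice), and let $A_\alpha\in\mathrm{Mat}_{m\times m}(\Lambda)$ be the matrix whose $(i,j)$ entry is $\sum\alpha(e)$, the sum over all directed edges $e$ from $v_i$ to $v_j$. For a finite group $H$ let $\mathrm{Nrd}\colon\mathrm{Mat}_{b\times b}(\mathbb{Q}_p[H])\to Z(\mathbb{Q}_p[H])$ be the reduced norm (over a splitting $\overline{\mathbb{Q}}_p[H]\cong\prod_i\mathrm{Mat}_{d_i}(\overline{\mathbb{Q}}_p)$ it is the determinant in each component), and let $I(\mathbb{Z}_p[H])\subseteq\mathbb{Q}_p[H]$ be the $Z(\mathbb{Z}_p[H])$-submodule generated by all $\mathrm{Nrd}(B)$ with $B\in\mathrm{Mat}_{b\times b}(\mathbb{Z}_p[H])$, $b\in\mathbb{N}$;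 it is a ring. Put $I(\Lambda)=\varprojlim_n I(\mathbb{Z}_p[G^{(n)}])$, and for a square matrix $B$ over $\Lambda$ let $\mathrm{Nrd}(B)\in I(\Lambda)$ be the system of the reduced norms of the images of $B$ over $\mathbb{Z}_p[G^{(n)}]$. For a finitely generated $\Lambda$-module $N$ let $\mathrm{Fitt}_\Lambda(N)$, the (maximal) Fitting invariant, be the ideal of $I(\Lambda)$ generated by the elements $\mathrm{Nrd}(B)$, where $B$ runs through the $b\times b$ submatrices of $h$ and $h$ through all matrices $h\in\mathrm{Mat}_{a\times b}(\Lambda)$, $a,b\in\mathbb{N}$, for which there is an exact sequence $\Lambda^a\xrightarrow{\,x\mapsto xh\,}\Lambda^b\to N\to 0$ (row vectors). If $X_n$ is connected for every $n\ge 0$, then $$\mathrm{Fitt}_\Lambda(\mathrm{Pic}_\infty)=\langle\mathrm{Nrd}(D-A_\alpha)\rangle_{I(\Lambda)}$$ as ideals of $I(\Lambda)$. (If homomorphisms of left modules are written as matrices acting on columns, the matrix in question is the transpose $D-A_\alpha^t$, with entries in the opposite ring $\Lambda^{\mathrm{op}}$, and its reduced norm over $\Lambda^{\mathrm{op}}$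 is the same element.) -/

import Mathlib

noncomputable section

section ReducedNorm

variable {n : Type*} [Fintype n] [DecidableEq n]

/-- Reduced norm on `Mat_n(K[H])` attached to a splitting `K[H] ≅ ∏ Mat_{d i}(K)`: the component at
`i` is the determinant of the `(n * d i) × (n * d i)` matrix over `K` at `i`, viewed as a scalar. -/
def splitNrd {K H : Type*} [Field K] [Group H] {s : ℕ} {d : Fin s → ℕ}
    (e : MonoidAlgebra K H ≃ₐ[K] Π i, Matrix (Fin (d i)) (Fin (d i)) K)
    (M : Matrix n n (MonoidAlgebra K H)) : MonoidAlgebra K H :=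
  e.symm fun i => Matrix.scalar (Fin (d i))
    (Matrix.comp n n (Fin (d i)) (Fin (d i)) K (M.map fun x => e x i)).det

/-- `z` has, for every surjection of `K[H]` onto a matrix algebra over `K`, the scalar matrix of
the determinant of `M` as its image. -/
def IsSplitNrd {K H : Type*} [Field K] [Group H]
    (M : Matrix n n (MonoidAlgebra K H)) (z : MonoidAlgebra K H) : Prop :=
  ∀ (d : ℕ) (φ : MonoidAlgebra K H →ₐ[K] Matrix (Fin d) (Fin d) K), Function.Surjective φ →
    φ z = Matrix.scalar (Fin d) (Matrix.comp n n (Fin d) (Fin d) K (M.map φ)).det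

theorem det_comp_algEquiv {K : Type*} [Field K] {a b : ℕ}
    (ψ : Matrix (Fin a) (Fin a) K ≃ₐ[K] Matrix (Fin b) (Fin b) K)
    (M : Matrix n n (Matrix (Fin a) (Fin a) K)) :
    (Matrix.comp n n (Fin b) (Fin b) K (M.map ψ)).det =
      (Matrix.comp n n (Fin a) (Fin a) K M).det := by
  obtain ⟨T, hT⟩ := AlgEquiv.eq_linearEquivConjAlgEquiv
    ((Matrix.toLinAlgEquiv' (R := K) (n := Fin a)).symm.trans
      (ψ.trans (Matrix.toLinAlgEquiv' (R := K) (n := Fin b))))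
  set P : Matrix (Fin b) (Fin a) K := LinearMap.toMatrix' (T : (Fin a → K) →ₗ[K] (Fin b → K))
  set Q : Matrix (Fin a) (Fin b) K := LinearMap.toMatrix' (T.symm : (Fin b → K) →ₗ[K] (Fin a → K))
  have hPQ : P * Q = 1 := by
    rw [← LinearMap.toMatrix'_comp]; simp
  have hQP : Q * P = 1 := by
    rw [← LinearMap.toMatrix'_comp]; simp
  have hψ : ∀ y, ψ y = P * y * Q := by
    intro y
    have h1 := congrArg (fun f => LinearMap.toMatrix' (f (Matrix.toLinAlgEquiv' y))) hT
    simp only [AlgEquiv.trans_apply, AlgEquiv.symm_apply_apply, LinearEquiv.conjAlgEquiv_apply,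
      LinearMap.toMatrix'_comp] at h1
    have h2 : ∀ (c : ℕ) (z : Matrix (Fin c) (Fin c) K),
        LinearMap.toMatrix' (Matrix.toLinAlgEquiv' z) = z := fun c z =>
      LinearMap.toMatrix'_toLin' z
    rw [h2, h2] at h1
    rw [h1, Matrix.mul_assoc]
  have key : Matrix.comp n n (Fin b) (Fin b) K (M.map ψ) =
      Matrix.kroneckerMap (· * ·) (1 : Matrix n n K) P * Matrix.comp n n (Fin a) (Fin a) K M *
        Matrix.kroneckerMap (· * ·) (1 : Matrix n n K) Q := by
    ext ⟨i, k⟩ ⟨j, l⟩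
    simp [Matrix.mul_apply, Fintype.sum_prod_type, Matrix.one_apply, hψ, Matrix.kroneckerMap_apply,
      Matrix.comp_apply, ite_mul, mul_ite, Finset.sum_ite_irrel]
  rw [key, Matrix.det_conj_of_mul_eq_one]
  · rw [← Matrix.mul_kronecker_mul, hPQ, Matrix.one_mul, Matrix.one_kronecker_one]
  · rw [← Matrix.mul_kronecker_mul, hQP, Matrix.one_mul, Matrix.one_kronecker_one]

theorem exists_component {K : Type*} [Field K] {s : ℕ} {d : Fin s → ℕ} {c : ℕ} [NeZero c]
    (φ : (Π i, Matrix (Fin (d i)) (Fin (d i)) K) →ₐ[K] Matrix (Fin c) (Fin c) K)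
    (hφ : Function.Surjective φ) :
    ∃ (i : Fin s) (ψ : Matrix (Fin (d i)) (Fin (d i)) K ≃ₐ[K] Matrix (Fin c) (Fin c) K),
      ∀ x, φ x = ψ (x i) := by
  have hsum : ∑ i, φ (Pi.single i 1) = 1 := by
    have h := Finset.univ_sum_single (1 : Π i, Matrix (Fin (d i)) (Fin (d i)) K)
    simp only [Pi.one_apply] at h
    rw [← map_sum, h, map_one]
  obtain ⟨i, hi⟩ : ∃ i, φ (Pi.single i 1) ≠ 0 := by
    by_contra! h
    simp [h] at hsum
  have hid : IsIdempotentElem (φ (Pi.single i 1)) := by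
    rw [IsIdempotentElem, ← map_mul, ← Pi.single_mul, one_mul]
  have hcen : φ (Pi.single i 1) ∈ Subalgebra.center K (Matrix (Fin c) (Fin c) K) := by
    rw [Subalgebra.mem_center_iff]
    intro y
    obtain ⟨x, rfl⟩ := hφ y
    rw [← map_mul, ← map_mul]
    congr 1
    ext1 j
    by_cases h : j = i
    · subst h; simp
    · simp [h]
  rw [Algebra.IsCentral.center_eq_bot, Algebra.mem_bot] at hcen
  obtain ⟨r, hr⟩ := hcen
  have h1 : φ (Pi.single i 1) = 1 := by
    rw [← hr] at hid hi ⊢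
    have : r * r = r := by
      have := hid.eq
      rw [← map_mul] at this
      exact (algebraMap K (Matrix (Fin c) (Fin c) K)).injective this
    rcases mul_eq_left₀ (a := r) (b := r) (by rintro rfl; simp at hi) |>.1 this with rfl
    simp
  let ψ₀ : Matrix (Fin (d i)) (Fin (d i)) K →ₐ[K] Matrix (Fin c) (Fin c) K :=
    { toFun := fun y => φ (Pi.single i y)
      map_one' := h1
      map_mul' := fun x y => by rw [Pi.single_mul, map_mul]
      map_zero' := by simp
      map_add' := fun x y => by rw [Pi.single_add, map_add]
      commutes' := fun r => by
        rw [Algebra.algebraMap_eq_smul_one, Pi.single_smul, map_smul, h1,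
          Algebra.algebraMap_eq_smul_one] }
  have hψ : ∀ x, φ x = ψ₀ (x i) := by
    intro x
    have : φ x = φ (Pi.single i 1 * x) := by rw [map_mul, h1, one_mul]
    rw [this]
    change _ = φ (Pi.single i (x i))
    congr 1
    ext1 j
    by_cases h : j = i
    · subst h; simp
    · simp [h]
  have hne : NeZero (d i) := ⟨fun h => hi (by
    have : IsEmpty (Fin (d i)) := by rw [h]; infer_instance
    have h0 : (1 : Matrix (Fin (d i)) (Fin (d i)) K) = 0 := Subsingleton.elim _ _
    rw [h0]; simp)⟩
  have hinj : Function.Injective ψ₀ := ψ₀.toRingHom.injective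
  have hsurj : Function.Surjective ψ₀ := fun y => by
    obtain ⟨x, rfl⟩ := hφ y
    exact ⟨x i, (hψ x).symm⟩
  exact ⟨i, AlgEquiv.ofBijective ψ₀ ⟨hinj, hsurj⟩, hψ⟩

theorem isSplitNrd_splitNrd {K H : Type*} [Field K] [Group H] {s : ℕ} {d : Fin s → ℕ}
    (e : MonoidAlgebra K H ≃ₐ[K] Π i, Matrix (Fin (d i)) (Fin (d i)) K)
    (M : Matrix n n (MonoidAlgebra K H)) : IsSplitNrd M (splitNrd e M) := by
  intro c φ hφ
  rcases Nat.eq_zero_or_pos c with rfl | hc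
  · exact Subsingleton.elim _ _
  have : NeZero c := ⟨hc.ne'⟩
  obtain ⟨i, ψ, hψ⟩ := exists_component (φ.comp e.symm.toAlgHom)
    (hφ.comp e.symm.surjective)
  have hφψ : ∀ x, φ x = ψ (e x i) := fun x => by
    rw [← hψ]; simp
  have h2 : M.map φ = (M.map fun x => e x i).map ψ := by
    ext1 a b; simp [hφψ]
  rw [h2, det_comp_algEquiv, hφψ, splitNrd, AlgEquiv.apply_symm_apply]
  exact ψ.commutes _

theorem IsSplitNrd.eq_splitNrd {K H : Type*} [Field K] [Group H] {s : ℕ} {d : Fin s → ℕ}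
    (e : MonoidAlgebra K H ≃ₐ[K] Π i, Matrix (Fin (d i)) (Fin (d i)) K)
    {M : Matrix n n (MonoidAlgebra K H)} {z : MonoidAlgebra K H} (h : IsSplitNrd M z) :
    z = splitNrd e M := by
  apply e.injective
  ext1 i
  rw [splitNrd, AlgEquiv.apply_symm_apply]
  exact h (d i) ((Pi.evalAlgHom K _ i).comp e.toAlgHom)
    ((Function.surjective_eval i).comp e.surjective)

theorem exists_splitting (F : Type*) [Field F] [CharZero F] (H : Type*) [Group H] [Finite H] :
    ∃ (s : ℕ) (d : Fin s → ℕ),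
      Nonempty (MonoidAlgebra (AlgebraicClosure F) H ≃ₐ[AlgebraicClosure F]
        Π i, Matrix (Fin (d i)) (Fin (d i)) (AlgebraicClosure F)) := by
  have : NeZero (Nat.card H : AlgebraicClosure F) := ⟨by
    exact_mod_cast Nat.card_pos.ne'⟩
  have : Module.Finite (AlgebraicClosure F) (MonoidAlgebra (AlgebraicClosure F) H) := inferInstance
  have : IsSemisimpleRing (MonoidAlgebra (AlgebraicClosure F) H) := by
    unfold IsSemisimpleRing; infer_instance
  obtain ⟨s, d, -, he⟩ := IsSemisimpleRing.exists_algEquiv_pi_matrix_of_isAlgClosed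
    (AlgebraicClosure F) (MonoidAlgebra (AlgebraicClosure F) H)
  exact ⟨s, d, he⟩

/-- Extension of scalars `F[H] → F̄[H]`. -/
abbrev toClosure {F H : Type*} [Field F] [Group H] :
    MonoidAlgebra F H →+* MonoidAlgebra (AlgebraicClosure F) H :=
  MonoidAlgebra.mapRingHom H (algebraMap F (AlgebraicClosure F))

theorem toClosure_injective {F H : Type*} [Field F] [Group H] :
    Function.Injective (toClosure : MonoidAlgebra F H →+* _) := by
  intro x y h
  ext g
  have := congrArg (fun z => z.coeff g) h
  simpa using this

/-- A field automorphism applied to the coefficients and the matrix entries. -/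
def conjHom {F H : Type*} [Field F] [Group H] (σ : AlgebraicClosure F ≃ₐ[F] AlgebraicClosure F)
    {d : ℕ} (φ : MonoidAlgebra (AlgebraicClosure F) H →ₐ[AlgebraicClosure F]
      Matrix (Fin d) (Fin d) (AlgebraicClosure F)) :
    MonoidAlgebra (AlgebraicClosure F) H →ₐ[AlgebraicClosure F]
      Matrix (Fin d) (Fin d) (AlgebraicClosure F) :=
  { ((σ.symm : AlgebraicClosure F →+* AlgebraicClosure F).mapMatrix.comp φ.toRingHom).comp
      (MonoidAlgebra.mapRingHom H (σ : AlgebraicClosure F →+* AlgebraicClosure F)) with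
    commutes' := fun r => by
      have h : MonoidAlgebra.mapRingHom H (σ : AlgebraicClosure F →+* AlgebraicClosure F)
          (algebraMap _ _ r) = algebraMap _ _ (σ r) := by
        ext g
        simp [MonoidAlgebra.coe_algebraMap]
      simp only [RingHom.toMonoidHom_eq_coe, OneHom.toFun_eq_coe, MonoidHom.toOneHom_coe,
        MonoidHom.coe_coe, RingHom.comp_apply, h]
      change (φ _).map _ = _
      rw [φ.commutes]
      ext a b
      by_cases hab : a = b <;> simp [Matrix.algebraMap_matrix_apply, hab] }

theorem conjHom_apply {F H : Type*} [Field F] [Group H]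
    (σ : AlgebraicClosure F ≃ₐ[F] AlgebraicClosure F)
    {d : ℕ} (φ : MonoidAlgebra (AlgebraicClosure F) H →ₐ[AlgebraicClosure F]
      Matrix (Fin d) (Fin d) (AlgebraicClosure F)) (x : MonoidAlgebra (AlgebraicClosure F) H) :
    conjHom σ φ x = (φ (MonoidAlgebra.mapRingHom H
      (σ : AlgebraicClosure F →+* AlgebraicClosure F) x)).map σ.symm := rfl

theorem IsSplitNrd.conj {F H : Type*} [Field F] [Group H] {M : Matrix n n (MonoidAlgebra F H)}
    {z : MonoidAlgebra (AlgebraicClosure F) H} (h : IsSplitNrd (M.map toClosure) z)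
    (σ : AlgebraicClosure F ≃ₐ[F] AlgebraicClosure F) :
    IsSplitNrd (M.map toClosure)
      (MonoidAlgebra.mapRingHom H (σ : AlgebraicClosure F →+* AlgebraicClosure F) z) := by
  intro d φ hφ
  have hsurj : Function.Surjective (conjHom σ φ) := by
    intro y
    obtain ⟨x, hx⟩ := hφ (y.map σ)
    refine ⟨MonoidAlgebra.mapRingHom H (σ.symm : AlgebraicClosure F →+* AlgebraicClosure F) x, ?_⟩
    have h1 : MonoidAlgebra.mapRingHom H (σ : AlgebraicClosure F →+* AlgebraicClosure F)
        (MonoidAlgebra.mapRingHom H (σ.symm : AlgebraicClosure F →+* AlgebraicClosure F) x) = x := by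
      ext g; simp
    rw [conjHom_apply, h1, hx]
    ext a b; simp
  have h1 := h d (conjHom σ φ) hsurj
  have h2 : (M.map toClosure).map (conjHom σ φ) =
      ((M.map toClosure).map φ).map fun y => y.map σ.symm := by
    ext1 a b
    simp only [Matrix.map_apply, conjHom_apply]
    congr 2
    ext g; simp
  rw [h2, Matrix.comp_map_map, conjHom_apply] at h1
  have h3 := congrArg (fun y : Matrix (Fin d) (Fin d) (AlgebraicClosure F) => y.map σ) h1
  have h4 : ∀ N : Matrix (n × Fin d) (n × Fin d) (AlgebraicClosure F),
      (N.map σ.symm).det = σ.symm N.det := fun N =>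
    ((σ.symm : AlgebraicClosure F →+* AlgebraicClosure F).map_det N).symm
  rw [h4] at h3
  have h5 : ∀ y : Matrix (Fin d) (Fin d) (AlgebraicClosure F),
      (y.map σ.symm).map σ = y := fun y => by ext a b; simp
  simp only [h5] at h3
  rw [h3]
  ext a b
  by_cases hab : a = b <;> simp [hab]

theorem exists_nrd {F H : Type*} [Field F] [CharZero F] [Group H] [Finite H]
    (M : Matrix n n (MonoidAlgebra F H)) :
    ∃ z : MonoidAlgebra F H, IsSplitNrd (M.map toClosure) (toClosure z) := by
  obtain ⟨s, d, ⟨e⟩⟩ := exists_splitting F H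
  have hz := isSplitNrd_splitNrd e (M.map toClosure)
  set z := splitNrd e (M.map toClosure)
  have hfix : ∀ g, ∃ c : F, algebraMap F (AlgebraicClosure F) c = z.coeff g := by
    intro g
    rw [← Set.mem_range, InfiniteGalois.mem_range_algebraMap_iff_fixed]
    intro σ
    have h := (hz.conj σ).eq_splitNrd e
    have := congrArg (fun w => w.coeff g) h
    simpa using this
  choose c hc using hfix
  refine ⟨⟨Finsupp.equivFunOnFinite.symm c⟩, ?_⟩
  have : toClosure (⟨Finsupp.equivFunOnFinite.symm c⟩ : MonoidAlgebra F H) = z := by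
    ext g
    simp [hc]
  rwa [this]

/-- The reduced norm computed by a splitting of `F̄[H]` has coefficients in `F` and does not depend
on the splitting. -/
theorem exists_unique_nrd {F H : Type*} [Field F] [CharZero F] [Group H] [Finite H]
    (M : Matrix n n (MonoidAlgebra F H)) :
    ∃! z : MonoidAlgebra F H, ∀ (s : ℕ) (d : Fin s → ℕ)
      (e : MonoidAlgebra (AlgebraicClosure F) H ≃ₐ[AlgebraicClosure F]
        Π i, Matrix (Fin (d i)) (Fin (d i)) (AlgebraicClosure F)),
      toClosure z = splitNrd e (M.map toClosure) := by
  obtain ⟨z, hz⟩ := exists_nrd M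
  obtain ⟨s, d, ⟨e⟩⟩ := exists_splitting F H
  refine ⟨z, fun s d e => hz.eq_splitNrd e, fun y hy => toClosure_injective ?_⟩
  rw [hy s d e, ← hz.eq_splitNrd e]

/-- The reduced norm `Mat_n(F[H]) → F[H]` for a finite group `H`: determinants over the components
of a splitting of `F̄[H]`. The values are central and lie in `F[H]`. -/
def Nrd {F H : Type*} [Field F] [CharZero F] [Group H] [Finite H]
    (M : Matrix n n (MonoidAlgebra F H)) : MonoidAlgebra F H :=
  (exists_unique_nrd M).choose

theorem isSplitNrd_Nrd {F H : Type*} [Field F] [CharZero F] [Group H] [Finite H]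
    (M : Matrix n n (MonoidAlgebra F H)) : IsSplitNrd (M.map toClosure) (toClosure (Nrd M)) := by
  obtain ⟨s, d, ⟨e⟩⟩ := exists_splitting F H
  rw [Nrd, (exists_unique_nrd M).choose_spec.1 s d e]
  exact isSplitNrd_splitNrd e _

theorem eq_Nrd {F H : Type*} [Field F] [CharZero F] [Group H] [Finite H]
    {M : Matrix n n (MonoidAlgebra F H)} {z : MonoidAlgebra F H}
    (h : IsSplitNrd (M.map toClosure) (toClosure z)) : z = Nrd M := by
  obtain ⟨s, d, ⟨e⟩⟩ := exists_splitting F H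
  apply toClosure_injective
  rw [h.eq_splitNrd e, (isSplitNrd_Nrd M).eq_splitNrd e]

theorem Nrd_one {F H : Type*} [Field F] [CharZero F] [Group H] [Finite H] :
    Nrd (1 : Matrix n n (MonoidAlgebra F H)) = 1 := by
  refine (eq_Nrd fun d φ _ => ?_).symm
  rw [Matrix.map_one _ (map_zero _) (map_one _), Matrix.map_one _ (map_zero _) (map_one _),
    Matrix.comp_one]
  simp

theorem Nrd_mul_Nrd {m : Type*} [Fintype m] [DecidableEq m]
    {F H : Type*} [Field F] [CharZero F] [Group H] [Finite H]
    (M : Matrix n n (MonoidAlgebra F H)) (N : Matrix m m (MonoidAlgebra F H)) :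
    Nrd M * Nrd N = Nrd (Matrix.fromBlocks M 0 0 N) := by
  refine eq_Nrd fun d φ hφ => ?_
  have h : (Matrix.comp (n ⊕ m) (n ⊕ m) (Fin d) (Fin d) (AlgebraicClosure F)
      (((Matrix.fromBlocks M 0 0 N).map toClosure).map φ)).submatrix
        (Equiv.sumProdDistrib n m (Fin d)).symm (Equiv.sumProdDistrib n m (Fin d)).symm =
      Matrix.fromBlocks (Matrix.comp n n _ _ _ ((M.map toClosure).map φ)) 0 0
        (Matrix.comp m m _ _ _ ((N.map toClosure).map φ)) := by
    ext (⟨i, a⟩ | ⟨i, a⟩) (⟨j, b⟩ | ⟨j, b⟩) <;> simp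
  rw [map_mul, map_mul, isSplitNrd_Nrd M d φ hφ, isSplitNrd_Nrd N d φ hφ, ← map_mul,
    ← Matrix.det_submatrix_equiv_self (Equiv.sumProdDistrib n m (Fin d)).symm
      (Matrix.comp (n ⊕ m) (n ⊕ m) _ _ _ _), h, Matrix.det_fromBlocks_zero₂₁]

theorem Nrd_reindex {m : Type*} [Fintype m] [DecidableEq m]
    {F H : Type*} [Field F] [CharZero F] [Group H] [Finite H] (f : n ≃ m)
    (M : Matrix n n (MonoidAlgebra F H)) : Nrd (M.submatrix f.symm f.symm) = Nrd M := by
  refine (eq_Nrd fun d φ hφ => ?_).symm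
  have h : Matrix.comp m m (Fin d) (Fin d) (AlgebraicClosure F)
      (((M.submatrix f.symm f.symm).map toClosure).map φ) =
      (Matrix.comp n n _ _ _ ((M.map toClosure).map φ)).submatrix
        (f.prodCongr (Equiv.refl _)).symm (f.prodCongr (Equiv.refl _)).symm := by
    ext ⟨i, a⟩ ⟨j, b⟩; simp
  rw [h, Matrix.det_submatrix_equiv_self, isSplitNrd_Nrd M d φ hφ]

theorem map_Nrd {F H H' : Type*} [Field F] [CharZero F] [Group H] [Finite H]
    [Group H'] [Finite H'] (f : H →* H') (hf : Function.Surjective f)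
    (M : Matrix n n (MonoidAlgebra F H)) :
    MonoidAlgebra.mapDomainRingHom F f (Nrd M) =
      Nrd (M.map (MonoidAlgebra.mapDomainRingHom F f)) := by
  refine eq_Nrd fun d φ hφ => ?_
  have hcomm : ∀ x : MonoidAlgebra F H, toClosure (MonoidAlgebra.mapDomainRingHom F f x) =
      MonoidAlgebra.mapDomainAlgHom (AlgebraicClosure F) (AlgebraicClosure F) f (toClosure x) :=
    fun x => congrArg (fun g : _ →+* _ => g x)
      (MonoidAlgebra.mapRingHom_comp_mapDomainRingHom (algebraMap F (AlgebraicClosure F)) f)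
  have hs : Function.Surjective
      (MonoidAlgebra.mapDomainAlgHom (AlgebraicClosure F) (AlgebraicClosure F) f) := by
    intro y
    induction y using MonoidAlgebra.induction_linear with
    | zero => exact ⟨0, map_zero _⟩
    | add a b ha hb =>
      obtain ⟨a, rfl⟩ := ha
      obtain ⟨b, rfl⟩ := hb
      exact ⟨a + b, map_add _ _ _⟩
    | single h r =>
      obtain ⟨g, rfl⟩ := hf h
      exact ⟨MonoidAlgebra.single g r, by simp⟩
  have h := isSplitNrd_Nrd M d (φ.comp (MonoidAlgebra.mapDomainAlgHom _ _ f)) (hφ.comp hs)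
  rw [hcomm]
  have h2 : ((M.map (MonoidAlgebra.mapDomainRingHom F f)).map toClosure).map φ =
      (M.map toClosure).map (φ.comp (MonoidAlgebra.mapDomainAlgHom _ _ f)) := by
    ext1 a b
    simp only [Matrix.map_apply, hcomm, AlgHom.comp_apply]
  rw [h2, ← h, AlgHom.comp_apply]

end ReducedNorm

section Uniform

/-- The closed subgroup `G^{p^n}` of `G` generated by all `p^n`-th powers. -/
def powSubgroup (p : ℕ) (G : Type*) [Group G] [TopologicalSpace G] [IsTopologicalGroup G]
    (n : ℕ) : Subgroup G :=
  (Subgroup.closure (Set.range fun g : G => g ^ p ^ n)).topologicalClosure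

instance powSubgroup_normal (p : ℕ) (G : Type*) [Group G] [TopologicalSpace G]
    [IsTopologicalGroup G] (n : ℕ) : (powSubgroup p G n).Normal := by
  have : (Subgroup.closure (Set.range fun g : G => g ^ p ^ n)).Normal := by
    refine ⟨fun x hx h => ?_⟩
    induction hx using Subgroup.closure_induction with
    | mem x hx =>
      obtain ⟨g, rfl⟩ := hx
      exact Subgroup.subset_closure ⟨h * g * h⁻¹, by simp⟩
    | one => simp
    | mul x y _ _ hx hy => simpa [mul_assoc] using mul_mem hx hy
    | inv x _ hx => simpa [mul_assoc] using inv_mem hx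
  exact Subgroup.is_normal_topologicalClosure _

theorem powSubgroup_anti (p : ℕ) (G : Type*) [Group G] [TopologicalSpace G]
    [IsTopologicalGroup G] {m n : ℕ} (h : m ≤ n) : powSubgroup p G n ≤ powSubgroup p G m := by
  refine Subgroup.topologicalClosure_mono ((Subgroup.closure_le _).2 ?_)
  rintro _ ⟨g, rfl⟩
  refine Subgroup.subset_closure ⟨g ^ p ^ (n - m), ?_⟩
  simp only
  rw [← pow_mul, ← pow_add, Nat.sub_add_cancel h]

/-- A profinite group `G` is a uniform pro-`p` group of dimension `l`. -/
structure IsUniformOfDim (p l : ℕ) (G : Type*) [Group G] [TopologicalSpace G]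
    [IsTopologicalGroup G] : Prop where
  compactSpace : CompactSpace G
  t2Space : T2Space G
  totallyDisconnectedSpace : TotallyDisconnectedSpace G
  isPGroup_quotient : ∀ N : OpenNormalSubgroup G, IsPGroup p (G ⧸ N.toSubgroup)
  exists_generators : ∃ s : Fin l → G,
    (Subgroup.closure (Set.range s)).topologicalClosure = ⊤
  layers : ∀ n : ℕ, Nonempty
    (powSubgroup p G n ⧸ (powSubgroup p G (n + 1)).subgroupOf (powSubgroup p G n) ≃*
      Multiplicative (Fin l → ZMod p))

/-- `G` is a uniform pro-`p` group (of some dimension). -/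
class IsUniformProP (p : ℕ) (G : Type*) [Group G] [TopologicalSpace G]
    [IsTopologicalGroup G] : Prop where
  exists_dim : ∃ l : ℕ, IsUniformOfDim p l G

/-- The quotient `G^{(n)} = G / G^{p^n}`. -/
abbrev Layer (p : ℕ) (G : Type*) [Group G] [TopologicalSpace G] [IsTopologicalGroup G]
    (n : ℕ) : Type _ :=
  G ⧸ powSubgroup p G n

instance finite_layer (p : ℕ) [hp : Fact p.Prime] (G : Type*) [Group G] [TopologicalSpace G]
    [IsTopologicalGroup G] [hG : IsUniformProP p G] (n : ℕ) : Finite (Layer p G n) := by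
  obtain ⟨l, hl⟩ := hG.exists_dim
  have : (powSubgroup p G n).index ≠ 0 := by
    induction n with
    | zero =>
      have : powSubgroup p G 0 = ⊤ := by
        refine top_unique (le_trans (fun g _ => ?_) (Subgroup.le_topologicalClosure _))
        exact Subgroup.subset_closure ⟨g, by simp⟩
      rw [this]; simp
    | succ n ih =>
      rw [← Subgroup.relIndex_mul_index (powSubgroup_anti p G n.le_succ)]
      refine mul_ne_zero ?_ ih
      obtain ⟨e⟩ := hl.layers n
      have : NeZero p := ⟨hp.out.ne_zero⟩
      have : Finite (Multiplicative (Fin l → ZMod p)) :=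
        inferInstanceAs (Finite (Fin l → ZMod p))
      have hf := Finite.of_equiv _ e.symm.toEquiv
      rw [Subgroup.relIndex, Subgroup.index]
      exact Nat.card_pos.ne'
  have : (powSubgroup p G n).FiniteIndex := ⟨this⟩
  exact Subgroup.finite_quotient_of_finiteIndex

variable (p : ℕ) (G : Type*) [Group G] [TopologicalSpace G] [IsTopologicalGroup G]

/-- The projection `G^{(n)} → G^{(m)}` for `m ≤ n`. -/
def layerMap {m n : ℕ} (h : m ≤ n) : Layer p G n →* Layer p G m :=
  QuotientGroup.map _ _ (MonoidHom.id G) (powSubgroup_anti p G h)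

theorem layerMap_surjective {m n : ℕ} (h : m ≤ n) : Function.Surjective (layerMap p G h) := by
  intro x
  obtain ⟨g, rfl⟩ := QuotientGroup.mk_surjective x
  exact ⟨QuotientGroup.mk g, rfl⟩

theorem layerMap_mul_mk {m n : ℕ} (h : m ≤ n) (g : Layer p G n) (a : G) :
    layerMap p G h (g * QuotientGroup.mk a) = layerMap p G h g * QuotientGroup.mk a := by
  rw [map_mul]; rfl

variable [Fact p.Prime]

/-- The Iwasawa algebra `Λ = ℤ_p⟦G⟧ = lim ℤ_p[G / G^{p^n}]`. -/
def Iwasawa : Subring (Π n, MonoidAlgebra ℤ_[p] (Layer p G n)) where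
  carrier := {x | ∀ (m n : ℕ) (h : m ≤ n),
    MonoidAlgebra.mapDomainRingHom ℤ_[p] (layerMap p G h) (x n) = x m}
  mul_mem' hx hy m n h := by simp only [Pi.mul_apply, map_mul, hx m n h, hy m n h]
  one_mem' m n h := by simp only [Pi.one_apply, map_one]
  add_mem' hx hy m n h := by simp only [Pi.add_apply, map_add, hx m n h, hy m n h]
  zero_mem' m n h := by simp only [Pi.zero_apply, map_zero]
  neg_mem' hx m n h := by simp only [Pi.neg_apply, map_neg, hx m n h]

variable {p G}

/-- The projection `π_n : Λ → ℤ_p[G^{(n)}]`. -/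
def Iwasawa.proj (n : ℕ) : Iwasawa p G →+* MonoidAlgebra ℤ_[p] (Layer p G n) :=
  (Pi.evalRingHom _ n).comp (Iwasawa p G).subtype

/-- The element of `Λ` given by a group element. -/
def Iwasawa.of (g : G) : Iwasawa p G :=
  ⟨fun n => MonoidAlgebra.of ℤ_[p] (Layer p G n) (QuotientGroup.mk g), fun m n h => by
    simp only [MonoidAlgebra.of_apply, MonoidAlgebra.mapDomainRingHom_apply,
      MonoidAlgebra.mapDomain_single]
    rfl⟩

end Uniform

section Fitting

variable (p : ℕ) [Fact p.Prime]

/-- The inclusion `ℤ_p[H] → ℚ_p[H]`. -/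
abbrev toRat (H : Type*) [Group H] : MonoidAlgebra ℤ_[p] H →+* MonoidAlgebra ℚ_[p] H :=
  MonoidAlgebra.mapRingHom H (algebraMap ℤ_[p] ℚ_[p])

/-- The center of `ℤ_p[H]`, inside `ℚ_p[H]`. -/
abbrev centerZp (H : Type*) [Group H] : Subring (MonoidAlgebra ℚ_[p] H) :=
  (Subring.center (MonoidAlgebra ℤ_[p] H)).map (toRat p H)

theorem centerZp_comm {H : Type*} [Group H] {c : MonoidAlgebra ℚ_[p] H} (hc : c ∈ centerZp p H)
    (x : MonoidAlgebra ℚ_[p] H) : x * c = c * x := by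
  obtain ⟨c, hc, rfl⟩ := hc
  have hc' := Subring.mem_center_iff.1 hc
  induction x using MonoidAlgebra.induction_linear with
  | zero => simp
  | add a b ha hb => rw [add_mul, mul_add, ha, hb]
  | single h r =>
    have h1 : MonoidAlgebra.single h r = r • toRat p H (MonoidAlgebra.of _ _ h) := by simp
    rw [h1, smul_mul_assoc, mul_smul_comm, ← map_mul, ← map_mul, hc']

/-- The `Z(ℤ_p[H])`-submodule of `ℚ_p[H]` generated by the reduced norms of all square matrices
over `ℤ_p[H]`. -/
def nrdSpan (H : Type*) [Group H] [Finite H] :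
    Submodule (centerZp p H) (MonoidAlgebra ℚ_[p] H) :=
  Submodule.span _ {x | ∃ (b : ℕ) (B : Matrix (Fin b) (Fin b) (MonoidAlgebra ℤ_[p] H)),
    x = Nrd (B.map (toRat p H))}

theorem nrd_mem_nrdSpan {n : Type*} [Fintype n] [DecidableEq n] {H : Type*} [Group H] [Finite H]
    (B : Matrix n n (MonoidAlgebra ℤ_[p] H)) : Nrd (B.map (toRat p H)) ∈ nrdSpan p H := by
  refine Submodule.subset_span ⟨Fintype.card n,
    B.submatrix (Fintype.equivFin n).symm (Fintype.equivFin n).symm, ?_⟩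
  rw [← Nrd_reindex (Fintype.equivFin n)]
  rfl

/-- `nrdSpan` is a ring: this is `I(ℤ_p[H])`. -/
def nrdRing (H : Type*) [Group H] [Finite H] : Subring (MonoidAlgebra ℚ_[p] H) where
  carrier := nrdSpan p H
  mul_mem' {x y} hx hy := by
    refine Submodule.span_induction (p := fun x _ => x * y ∈ nrdSpan p H) ?_ ?_ ?_ ?_ hx
    · rintro _ ⟨b, B, rfl⟩
      refine Submodule.span_induction
        (p := fun y _ => Nrd (B.map (toRat p H)) * y ∈ nrdSpan p H) ?_ ?_ ?_ ?_ hy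
      · rintro _ ⟨c, C, rfl⟩
        have h : Matrix.fromBlocks (B.map (toRat p H)) 0 0 (C.map (toRat p H)) =
            (Matrix.fromBlocks B 0 0 C).map (toRat p H) := by
          rw [Matrix.fromBlocks_map]; simp
        rw [Nrd_mul_Nrd, h]
        exact nrd_mem_nrdSpan p _
      · simp
      · intro y z _ _ hy hz
        rw [mul_add]; exact add_mem hy hz
      · intro c z _ hz
        have : Nrd (B.map (toRat p H)) * (c • z) = c • (Nrd (B.map (toRat p H)) * z) := by
          rw [Subring.smul_def, Subring.smul_def, smul_eq_mul, smul_eq_mul, ← mul_assoc,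
            centerZp_comm p c.2, mul_assoc]
        rw [this]; exact Submodule.smul_mem _ _ hz
    · simp
    · intro a b _ _ ha hb
      rw [add_mul]; exact add_mem ha hb
    · intro c a _ ha
      rw [smul_mul_assoc]; exact Submodule.smul_mem _ _ ha
  one_mem' := by
    have h := nrd_mem_nrdSpan p (1 : Matrix (Fin 1) (Fin 1) (MonoidAlgebra ℤ_[p] H))
    rwa [Matrix.map_one _ (map_zero _) (map_one _), Nrd_one] at h
  add_mem' hx hy := add_mem hx hy
  zero_mem' := zero_mem _
  neg_mem' hx := neg_mem hx

variable (G : Type*) [Group G] [TopologicalSpace G] [IsTopologicalGroup G] [IsUniformProP p G]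

/-- The ring `I(Λ) = lim I(ℤ_p[G^{(n)}])`. -/
def IwasawaNrdRing : Subring (Π n, MonoidAlgebra ℚ_[p] (Layer p G n)) where
  carrier := {x | (∀ n, x n ∈ nrdRing p (Layer p G n)) ∧ ∀ (m n : ℕ) (h : m ≤ n),
    MonoidAlgebra.mapDomainRingHom ℚ_[p] (layerMap p G h) (x n) = x m}
  mul_mem' hx hy := ⟨fun n => mul_mem (hx.1 n) (hy.1 n), fun m n h => by
    simp only [Pi.mul_apply, map_mul, hx.2 m n h, hy.2 m n h]⟩
  one_mem' := ⟨fun n => one_mem _, fun m n h => by simp only [Pi.one_apply, map_one]⟩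
  add_mem' hx hy := ⟨fun n => add_mem (hx.1 n) (hy.1 n), fun m n h => by
    simp only [Pi.add_apply, map_add, hx.2 m n h, hy.2 m n h]⟩
  zero_mem' := ⟨fun n => zero_mem _, fun m n h => by simp only [Pi.zero_apply, map_zero]⟩
  neg_mem' hx := ⟨fun n => neg_mem (hx.1 n), fun m n h => by
    simp only [Pi.neg_apply, map_neg, hx.2 m n h]⟩

variable {p G}

/-- The reduced norm of a square matrix over `Λ`: the compatible system of the reduced norms of its
images over `ℤ_p[G^{(n)}]`. -/
def IwasawaNrd {n : Type*} [Fintype n] [DecidableEq n] (M : Matrix n n (Iwasawa p G)) :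
    IwasawaNrdRing p G :=
  ⟨fun k => Nrd ((M.map (Iwasawa.proj k)).map (toRat p (Layer p G k))),
    fun _ => nrd_mem_nrdSpan p _, fun k l h => by
      rw [map_Nrd _ (layerMap_surjective p G h)]
      congr 1
      ext1 i j
      simp only [Matrix.map_apply]
      have h1 := (M i j).2 k l h
      have h2 := congrArg (fun g : _ →+* _ => g (Iwasawa.proj l (M i j)))
        (MonoidAlgebra.mapRingHom_comp_mapDomainRingHom (algebraMap ℤ_[p] ℚ_[p])
          (layerMap p G h))
      simp only [RingHom.comp_apply] at h2
      rw [← h2]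
      exact congrArg _ h1⟩

/-- The matrix `h`, acting on row vectors by right multiplication, is the first map of a
presentation `Λ^a → Λ^b → N → 0` of the left `Λ`-module `N`. -/
def IsPresentation {a b : ℕ} (h : Matrix (Fin a) (Fin b) (Iwasawa p G)) (N : Type*)
    [AddCommGroup N] [Module (Iwasawa p G) N] : Prop :=
  ∃ π : (Fin b → Iwasawa p G) →ₗ[Iwasawa p G] N, Function.Surjective π ∧
    LinearMap.ker π = LinearMap.range (Matrix.toLinearMapRight' h)

variable (p G)

/-- The (maximal) Fitting invariant of a `Λ`-module `N`: the ideal of `I(Λ)` generated by the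
reduced norms of all `b × b` submatrices of all finite presentations `Λ^a → Λ^b → N → 0`. -/
def fittingInvariant (N : Type*) [AddCommGroup N] [Module (Iwasawa p G) N] :
    Ideal (IwasawaNrdRing p G) :=
  Ideal.span {x | ∃ (a b : ℕ) (h : Matrix (Fin a) (Fin b) (Iwasawa p G)),
    IsPresentation h N ∧ ∃ r : Fin b ↪o Fin a, x = IwasawaNrd (h.submatrix r id)}

end Fitting

section Graph

/-- An undirected multigraph with vertex set `V` and edge set `E`, loops and multiple edges
allowed, together with the choice of a direction for every edge. -/
structure Multigraph (V E : Type*) where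
  src : E → V
  tgt : E → V

namespace Multigraph

variable {V E : Type*} (X : Multigraph V E)

/-- The start of a directed edge; `(e, true)` is `e` in the chosen direction and `(e, false)` is
the reversed edge. A loop gives two directed edges. -/
def dirSrc (d : E × Bool) : V := bif d.2 then X.src d.1 else X.tgt d.1

/-- The end of a directed edge. -/
def dirTgt (d : E × Bool) : V := bif d.2 then X.tgt d.1 else X.src d.1

/-- The extension of a voltage assignment to all directed edges. -/
def dirVolt {H : Type*} [Group H] (α : E → H) (d : E × Bool) : H :=
  bif d.2 then α d.1 else (α d.1)⁻¹

/-- A multigraph is connected if any two vertices are joined by a path (and there is a vertex). -/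
def Connected : Prop :=
  (SimpleGraph.fromRel fun v w => ∃ e, X.src e = v ∧ X.tgt e = w).Connected

/-- The derived graph of a voltage assignment `α`: over every edge `e : v → w` and every `g` there
is one edge from `(v, g)` to `(w, g α(e))`. -/
def derived {H : Type*} [Group H] (α : E → H) : Multigraph (V × H) (E × H) where
  src e := (X.src e.1, e.2)
  tgt e := (X.tgt e.1, e.2 * α e.1)

variable (k : Type*) [CommRing k]

/-- The divisor `∑ (v - w)`, the sum over all directed edges `v → w` starting at `v`. -/
def firing (v : V) : V →₀ k :=
  ∑ᶠ (d : E × Bool) (_ : d ∈ {d | X.dirSrc d = v}),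
    (Finsupp.single v 1 - Finsupp.single (X.dirTgt d) 1)

/-- Principal divisors (with coefficients in `k`). -/
def principal : Submodule k (V →₀ k) := Submodule.span k (Set.range (X.firing k))

/-- The Picard group (with coefficients in `k`). -/
def Pic : Type _ := (V →₀ k) ⧸ X.principal k

instance : AddCommGroup (X.Pic k) := inferInstanceAs (AddCommGroup ((V →₀ k) ⧸ X.principal k))

instance : Module k (X.Pic k) := inferInstanceAs (Module k ((V →₀ k) ⧸ X.principal k))

/-- The class of a divisor. -/
def picMk : (V →₀ k) →ₗ[k] X.Pic k := (X.principal k).mkQ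

theorem pic_hom_ext {M : Type*} [AddCommGroup M] [Module k M] {f g : X.Pic k →ₗ[k] M}
    (h : ∀ v, f (X.picMk k (Finsupp.single v 1)) = g (X.picMk k (Finsupp.single v 1))) : f = g := by
  refine Submodule.linearMap_qext _ (Finsupp.lhom_ext' fun v => LinearMap.ext_ring ?_)
  exact h v

variable {H H' : Type*} [Group H] [Group H']

theorem firing_derived (α : E → H) (v : V) (g : H) :
    (X.derived α).firing k (v, g) = ∑ᶠ (d : E × Bool) (_ : d ∈ {d | X.dirSrc d = v}),
      (Finsupp.single (v, g) 1 - Finsupp.single (X.dirTgt d, g * dirVolt α d) 1) := by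
  symm
  refine finsum_mem_eq_of_bijOn
    (fun d => ((d.1, bif d.2 then g else g * (α d.1)⁻¹), d.2)) ⟨?_, ?_, ?_⟩ ?_
  · rintro ⟨e, _ | _⟩ hd <;> simp_all [dirSrc, derived]
  · rintro ⟨e, _ | _⟩ _ ⟨e', _ | _⟩ _ h <;> simp_all
  · rintro ⟨⟨e, h⟩, _ | _⟩ hd
    · simp only [dirSrc, derived, Set.mem_ofPred_eq, cond_false, Prod.mk.injEq] at hd
      refine ⟨(e, false), by simp [dirSrc, hd.1], ?_⟩
      simp [← hd.2]
    · simp only [dirSrc, derived, Set.mem_ofPred_eq, cond_true, Prod.mk.injEq] at hd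
      refine ⟨(e, true), by simp [dirSrc, hd.1], ?_⟩
      simp [hd.2]
  · rintro ⟨e, _ | _⟩ _ <;> simp [dirTgt, dirVolt, derived]

theorem map_firing [Finite E] {α : E → H} {α' : E → H'} (θ : H → H')
    (hθ : ∀ g e, θ (g * α e) = θ g * α' e) (v : V) (g : H) :
    Finsupp.lmapDomain k k (Prod.map id θ) ((X.derived α).firing k (v, g)) =
      (X.derived α').firing k (v, θ g) := by
  have hθ' : ∀ g d, θ (g * dirVolt α d) = θ g * dirVolt α' d := by
    rintro g ⟨e, _ | _⟩
    · have := hθ (g * (α e)⁻¹) e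
      rw [inv_mul_cancel_right] at this
      simp [dirVolt, this]
    · simp [dirVolt, hθ]
  rw [firing_derived, firing_derived]
  have h := AddMonoidHom.map_finsum_mem
    (fun d => (Finsupp.single (v, g) 1 - Finsupp.single (X.dirTgt d, g * dirVolt α d) 1 :
      V × H →₀ k)) (Finsupp.lmapDomain k k (Prod.map id θ)).toAddMonoidHom
      (Set.toFinite {d | X.dirSrc d = v})
  refine h.trans (finsum_mem_congr rfl fun d _ => ?_)
  simp [Finsupp.mapDomain_sub, Finsupp.mapDomain_single, hθ']

/-- The map of Picard groups of derived graphs induced by `(v, g) ↦ (v, θ g)`. -/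
def picMap [Finite E] {α : E → H} {α' : E → H'} (θ : H → H')
    (hθ : ∀ g e, θ (g * α e) = θ g * α' e) :
    (X.derived α).Pic k →ₗ[k] (X.derived α').Pic k :=
  Submodule.mapQ _ _ (Finsupp.lmapDomain k k (Prod.map id θ)) <| by
    refine Submodule.span_le.2 ?_
    rintro _ ⟨⟨v, g⟩, rfl⟩
    refine Submodule.subset_span ⟨(v, θ g), ?_⟩
    exact (X.map_firing k θ hθ v g).symm

theorem picMap_mk [Finite E] {α : E → H} {α' : E → H'} (θ : H → H')
    (hθ : ∀ g e, θ (g * α e) = θ g * α' e) (v : V) (g : H) :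
    X.picMap k θ hθ ((X.derived α).picMk k (Finsupp.single (v, g) 1)) =
      (X.derived α').picMk k (Finsupp.single (v, θ g) 1) := by
  change Submodule.Quotient.mk _ = Submodule.Quotient.mk _
  simp

/-- The action of `H` on the Picard group of the derived graph, induced by
`h (v, g) = (v, h g)`. -/
def picRep [Finite E] (α : E → H) : Representation k H ((X.derived α).Pic k) where
  toFun h := X.picMap k (fun g => h * g) fun g e => (mul_assoc h g (α e)).symm
  map_one' := by
    refine pic_hom_ext _ _ fun ⟨v, g⟩ => ?_
    rw [picMap_mk, one_mul]; rfl
  map_mul' a b := by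
    refine pic_hom_ext _ _ fun ⟨v, g⟩ => ?_
    rw [Module.End.mul_apply, picMap_mk, picMap_mk, picMap_mk, mul_assoc]

instance picModule [Finite E] (α : E → H) :
    Module (MonoidAlgebra k H) ((X.derived α).Pic k) :=
  Module.compHom _ (X.picRep k α).asAlgebraHom.toRingHom

theorem picMap_smul [Finite E] {α : E → H} {α' : E → H'} (f : H →* H')
    (hf : ∀ g e, f (g * α e) = f g * α' e) (a : MonoidAlgebra k H) (x : (X.derived α).Pic k) :
    X.picMap k f hf (a • x) =
      MonoidAlgebra.mapDomainRingHom k f a • X.picMap k f hf x := by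
  induction a using MonoidAlgebra.induction_linear with
  | zero => simp
  | add a b ha hb => rw [add_smul, map_add, ha, hb, map_add, add_smul]
  | single h r =>
    have h1 : MonoidAlgebra.single h r • x =
        r • X.picMap k (fun g => h * g) (fun g e => (mul_assoc h g (α e)).symm) x := by
      change (X.picRep k α).asAlgebraHom (MonoidAlgebra.single h r) x = _
      rw [Representation.asAlgebraHom_single]; rfl
    have h2 : MonoidAlgebra.single (f h) r • X.picMap k f hf x =
        r • X.picMap k (fun g => f h * g) (fun g e => (mul_assoc (f h) g (α' e)).symm)
          (X.picMap k f hf x) := by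
      change (X.picRep k α').asAlgebraHom (MonoidAlgebra.single (f h) r) _ = _
      rw [Representation.asAlgebraHom_single]; rfl
    rw [MonoidAlgebra.mapDomainRingHom_apply, MonoidAlgebra.mapDomain_single, h1, h2, map_smul]
    congr 1
    rw [← LinearMap.comp_apply, ← LinearMap.comp_apply]
    congr 1
    refine pic_hom_ext _ _ fun ⟨v, g⟩ => ?_
    rw [LinearMap.comp_apply, LinearMap.comp_apply, picMap_mk, picMap_mk, picMap_mk, picMap_mk,
      map_mul]

end Multigraph

variable {V E : Type*} (X : Multigraph V E) (p : ℕ) [Fact p.Prime]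
  {G : Type*} [Group G] [TopologicalSpace G] [IsTopologicalGroup G] (α : E → G)

/-- The `n`-th layer `X_n`: the derived graph of the voltage assignment `α` modulo `G^{p^n}`. -/
abbrev layerGraph (n : ℕ) : Multigraph (V × Layer p G n) (E × Layer p G n) :=
  X.derived fun e => (QuotientGroup.mk (α e) : Layer p G n)

/-- `Λ` acts on the product of the `Pic(X_n)`, through `ℤ_p[G^{(n)}]` on the `n`-th factor. -/
instance picProdModule [Finite E] :
    Module (Iwasawa p G) (Π n, (layerGraph X p α n).Pic ℤ_[p]) :=
  letI : Module (Π n, MonoidAlgebra ℤ_[p] (Layer p G n))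
      (Π n, (layerGraph X p α n).Pic ℤ_[p]) := Pi.module'
  Module.compHom _ (Iwasawa p G).subtype

/-- The map `Pic(X_n) → Pic(X_m)` for `m ≤ n`, induced by the covering `X_n → X_m`. -/
def layerPicMap [Finite E] {m n : ℕ} (h : m ≤ n) :
    (layerGraph X p α n).Pic ℤ_[p] →ₗ[ℤ_[p]] (layerGraph X p α m).Pic ℤ_[p] :=
  X.picMap ℤ_[p] (layerMap p G h) fun g e => layerMap_mul_mk p G h g (α e)

/-- `Pic_∞ = lim Pic(X_n)` (with coefficients in `ℤ_p`), as a left module over `Λ`. -/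
def PicLim [Finite E] : Submodule (Iwasawa p G) (Π n, (layerGraph X p α n).Pic ℤ_[p]) where
  carrier := {x | ∀ (m n : ℕ) (h : m ≤ n),
    layerPicMap X p α h (x n) = x m}
  add_mem' hx hy m n h := by
    simp only [Pi.add_apply, map_add, hx m n h, hy m n h]
  zero_mem' m n h := by simp only [Pi.zero_apply, map_zero]
  smul_mem' a x hx m n h := by
    have h1 : ∀ n, (a • x) n = (a.1 n) • x n := fun n => rfl
    have h2 := X.picMap_smul ℤ_[p] (layerMap p G h)
      (fun g e => layerMap_mul_mk p G h g (α e)) (a.1 n) (x n)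
    rw [a.2 m n h] at h2
    rw [h1, h1, ← hx m n h]
    exact h2

/-- The degree matrix `D`; the degree of `v` is the number of directed edges starting at `v`, so that
a loop counts twice. -/
def degreeMatrix [Fintype E] [DecidableEq V] : Matrix V V (Iwasawa p G) :=
  Matrix.diagonal fun v => ((Finset.univ.filter fun d => X.dirSrc d = v).card : Iwasawa p G)

/-- The adjacency matrix `A_α`; its `(v, w)` entry is the sum of `α(d)` over all directed edges
`d : v → w`. -/
def voltageMatrix [Fintype E] [DecidableEq V] : Matrix V V (Iwasawa p G) :=
  Matrix.of fun v w => ∑ d with X.dirSrc d = v ∧ X.dirTgt d = w,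
    Iwasawa.of (Multigraph.dirVolt α d)

end Graph

end

/-! The module `PicLim` has a presentation with as many relations as generators, its relation matrix
being Q = D - A_α; a general fact about Fitting invariants then finishes the proof.

The general fact is `fittingInvariant_eq_span`. Given a square presentation matrix Q and a square
matrix B of relations among another generating system, express each system of generators through the
other by matrices S and U. The rows of BS and of 1 - US are relations, hence left multiples of Q,
and this fits into a factorization of a block triangular matrix with diagonal blocks B and 1 whose
right-hand factor is block triangular with diagonal blocks 1 and Q. Multiplicativity of the reduced
norm shows that Nrd(B) is a multiple of Nrd(Q).

For the presentation, work first at a finite level. The free module on the vertices of a derived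
graph is k[H]^V, with (v, g) corresponding to g e_v, and firing (v, g) is g times the row of the
Laplacian at v. So Pic is the cokernel of right multiplication by the Laplacian
(`picPres_surjective`, `ker_picPres`). Inverse limits need not preserve surjectivity, nor
solvability of linear equations. Here they do, because the sets of solutions are nonempty compact
subsets of finite free ℤ_p-modules and so contain a compatible family
(`exists_compatible_preimage`). This is used twice: for generators of `PicLim` and for relations
among them. -/

/-! ### Multiplicativity of the reduced norm, also for block triangular matrices. -/

section ReducedNorm

variable {n m : Type*} [Fintype n] [DecidableEq n] [Fintype m] [DecidableEq m]

/-- The reduced norm is multiplicative. -/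
theorem Nrd_mul {F H : Type*} [Field F] [CharZero F] [Group H] [Finite H]
    (M N : Matrix n n (MonoidAlgebra F H)) : Nrd (M * N) = Nrd M * Nrd N := by
  refine (eq_Nrd fun d φ hφ => ?_).symm
  have h : Matrix.comp n n (Fin d) (Fin d) (AlgebraicClosure F)
      (((M * N).map toClosure).map φ) =
      Matrix.comp n n _ _ _ ((M.map toClosure).map φ) *
        Matrix.comp n n _ _ _ ((N.map toClosure).map φ) := by
    rw [Matrix.map_mul, Matrix.map_mul]
    exact map_mul (Matrix.compRingEquiv n (Fin d) (AlgebraicClosure F)) _ _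
  rw [map_mul, map_mul, isSplitNrd_Nrd M d φ hφ, isSplitNrd_Nrd N d φ hφ, ← map_mul, h,
    Matrix.det_mul]

/-- In each matrix component, regrouping the indices (n ⊕ m) × Fin d as n × Fin d ⊕ m × Fin d keeps
the flattened matrix block triangular, so the determinant formula over a field applies. -/
theorem Nrd_fromBlocks_zero₂₁ {F H : Type*} [Field F] [CharZero F] [Group H] [Finite H]
    (M : Matrix n n (MonoidAlgebra F H)) (P : Matrix n m (MonoidAlgebra F H))
    (N : Matrix m m (MonoidAlgebra F H)) :
    Nrd (Matrix.fromBlocks M P 0 N) = Nrd M * Nrd N := by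
  refine (eq_Nrd fun d φ hφ => ?_).symm
  have h : (Matrix.comp (n ⊕ m) (n ⊕ m) (Fin d) (Fin d) (AlgebraicClosure F)
      (((Matrix.fromBlocks M P 0 N).map toClosure).map φ)).submatrix
        (Equiv.sumProdDistrib n m (Fin d)).symm (Equiv.sumProdDistrib n m (Fin d)).symm =
      Matrix.fromBlocks (Matrix.comp n n _ _ _ ((M.map toClosure).map φ))
        (Matrix.comp n m _ _ _ ((P.map toClosure).map φ)) 0
        (Matrix.comp m m _ _ _ ((N.map toClosure).map φ)) := by
    ext (⟨i, a⟩ | ⟨i, a⟩) (⟨j, b⟩ | ⟨j, b⟩) <;> simp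
  rw [map_mul, map_mul, isSplitNrd_Nrd M d φ hφ, isSplitNrd_Nrd N d φ hφ, ← map_mul,
    ← Matrix.det_submatrix_equiv_self (Equiv.sumProdDistrib n m (Fin d)).symm
      (Matrix.comp (n ⊕ m) (n ⊕ m) _ _ _ _), h, Matrix.det_fromBlocks_zero₂₁]

theorem Nrd_fromBlocks_zero₁₂ {F H : Type*} [Field F] [CharZero F] [Group H] [Finite H]
    (M : Matrix n n (MonoidAlgebra F H)) (P : Matrix m n (MonoidAlgebra F H))
    (N : Matrix m m (MonoidAlgebra F H)) :
    Nrd (Matrix.fromBlocks M 0 P N) = Nrd M * Nrd N := by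
  refine (eq_Nrd fun d φ hφ => ?_).symm
  have h : (Matrix.comp (n ⊕ m) (n ⊕ m) (Fin d) (Fin d) (AlgebraicClosure F)
      (((Matrix.fromBlocks M 0 P N).map toClosure).map φ)).submatrix
        (Equiv.sumProdDistrib n m (Fin d)).symm (Equiv.sumProdDistrib n m (Fin d)).symm =
      Matrix.fromBlocks (Matrix.comp n n _ _ _ ((M.map toClosure).map φ)) 0
        (Matrix.comp m n _ _ _ ((P.map toClosure).map φ))
        (Matrix.comp m m _ _ _ ((N.map toClosure).map φ)) := by
    ext (⟨i, a⟩ | ⟨i, a⟩) (⟨j, b⟩ | ⟨j, b⟩) <;> simp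
  rw [map_mul, map_mul, isSplitNrd_Nrd M d φ hφ, isSplitNrd_Nrd N d φ hφ, ← map_mul,
    ← Matrix.det_submatrix_equiv_self (Equiv.sumProdDistrib n m (Fin d)).symm
      (Matrix.comp (n ⊕ m) (n ⊕ m) _ _ _ _), h, Matrix.det_fromBlocks_zero₁₂]

end ReducedNorm

/-! ### Matrices of maps between finite free modules. -/

section MatrixLift

/-- A linear map out of a finite free module lifts along a surjection, as a matrix acting on row
vectors. -/
theorem exists_matrix_lift {R N n m : Type*} [Ring R] [Fintype n] [DecidableEq n] [AddCommGroup N] [Module R N]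
    {π : (n → R) →ₗ[R] N} {ρ : (m → R) →ₗ[R] N} (hρ : Function.Surjective ρ) :
    ∃ S : Matrix n m R, ∀ x, ρ (Matrix.vecMul x S) = π x := by
  obtain ⟨f, hf⟩ := Module.projective_lifting_property ρ π hρ
  refine ⟨LinearMap.toMatrixRight' f, fun x => ?_⟩
  have h : Matrix.toLinearMapRight' (LinearMap.toMatrixRight' f) = f :=
    Matrix.toLinearMapRight'.apply_symm_apply f
  rw [← Matrix.toLinearMapRight'_apply, h, ← hf, LinearMap.comp_apply]

/-- If the rows of `A` lie in the row space of `Q` then `A` is a left multiple of `Q`. -/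
theorem exists_eq_mul_of_row_mem {R k n m : Type*} [Ring R] [Fintype n] [DecidableEq n] {A : Matrix k m R}
    {Q : Matrix n m R} (h : ∀ i, A i ∈ LinearMap.range (Matrix.toLinearMapRight' Q)) :
    ∃ T : Matrix k n R, A = T * Q := by
  choose T hT using h
  refine ⟨Matrix.of T, ?_⟩
  ext1 i j
  rw [← hT i]
  rfl

end MatrixLift

/-! ### Fitting invariants of modules with a square presentation. -/

section Fitting

variable {p : ℕ} [Fact p.Prime]
  {G : Type*} [Group G] [TopologicalSpace G] [IsTopologicalGroup G] [IsUniformProP p G]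
  {n m : Type*} [Fintype n] [DecidableEq n] [Fintype m] [DecidableEq m]

/-- Elements of I(Λ) are families indexed by the levels, so this and the next identities reduce to
reduced norms over each finite group ring. -/
theorem IwasawaNrd_mul (M N : Matrix n n (Iwasawa p G)) :
    IwasawaNrd (M * N) = IwasawaNrd M * IwasawaNrd N := by
  refine Subtype.ext (funext fun k => ?_)
  change Nrd (((M * N).map (Iwasawa.proj k)).map (toRat p (Layer p G k))) = Nrd _ * Nrd _
  rw [Matrix.map_mul, Matrix.map_mul, Nrd_mul]

theorem IwasawaNrd_one : IwasawaNrd (1 : Matrix n n (Iwasawa p G)) = 1 := by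
  refine Subtype.ext (funext fun k => ?_)
  change Nrd (((1 : Matrix n n (Iwasawa p G)).map (Iwasawa.proj k)).map
    (toRat p (Layer p G k))) = 1
  rw [Matrix.map_one _ (map_zero _) (map_one _), Matrix.map_one _ (map_zero _) (map_one _),
    Nrd_one]

theorem IwasawaNrd_fromBlocks_zero₂₁ (M : Matrix n n (Iwasawa p G))
    (P : Matrix n m (Iwasawa p G)) (N : Matrix m m (Iwasawa p G)) :
    IwasawaNrd (Matrix.fromBlocks M P 0 N) = IwasawaNrd M * IwasawaNrd N := by
  refine Subtype.ext (funext fun k => ?_)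
  change Nrd (((Matrix.fromBlocks M P 0 N).map (Iwasawa.proj k)).map (toRat p (Layer p G k))) =
    Nrd _ * Nrd _
  rw [Matrix.fromBlocks_map, Matrix.fromBlocks_map, Matrix.map_zero _ (map_zero _),
    Matrix.map_zero _ (map_zero _), Nrd_fromBlocks_zero₂₁]

theorem IwasawaNrd_fromBlocks_zero₁₂ (M : Matrix n n (Iwasawa p G))
    (P : Matrix m n (Iwasawa p G)) (N : Matrix m m (Iwasawa p G)) :
    IwasawaNrd (Matrix.fromBlocks M 0 P N) = IwasawaNrd M * IwasawaNrd N := by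
  refine Subtype.ext (funext fun k => ?_)
  change Nrd (((Matrix.fromBlocks M 0 P N).map (Iwasawa.proj k)).map (toRat p (Layer p G k))) =
    Nrd _ * Nrd _
  rw [Matrix.fromBlocks_map, Matrix.fromBlocks_map, Matrix.map_zero _ (map_zero _),
    Matrix.map_zero _ (map_zero _), Nrd_fromBlocks_zero₁₂]

theorem IwasawaNrd_reindex (f : n ≃ m) (M : Matrix n n (Iwasawa p G)) :
    IwasawaNrd (M.submatrix f.symm f.symm) = IwasawaNrd M := by
  refine Subtype.ext (funext fun k => ?_)
  change Nrd (((M.map (Iwasawa.proj k)).map (toRat p (Layer p G k))).submatrix f.symm f.symm) =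
    Nrd ((M.map (Iwasawa.proj k)).map (toRat p (Layer p G k)))
  exact Nrd_reindex f _

/-- If `N` has a presentation by a square matrix `Q`, the reduced norm of every square matrix of
relations among some generators of `N` is a multiple of the reduced norm of `Q`. -/
theorem IwasawaNrd_mem_span_of_relations {N : Type*} [AddCommGroup N] [Module (Iwasawa p G) N]
    {π : (n → Iwasawa p G) →ₗ[Iwasawa p G] N} (hπ : Function.Surjective π)
    {ρ : (m → Iwasawa p G) →ₗ[Iwasawa p G] N} (hρ : Function.Surjective ρ)
    {Q : Matrix m m (Iwasawa p G)}
    (hQ : LinearMap.ker ρ = LinearMap.range (Matrix.toLinearMapRight' Q))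
    {B : Matrix n n (Iwasawa p G)} (hB : ∀ i, π (B i) = 0) :
    IwasawaNrd B ∈ Ideal.span {IwasawaNrd Q} := by
  obtain ⟨S, hS⟩ := exists_matrix_lift (π := π) hρ
  obtain ⟨U, hU⟩ := exists_matrix_lift (π := ρ) hπ
  have h₁ : ∀ i, (B * S) i ∈ LinearMap.range (Matrix.toLinearMapRight' Q) := fun i => by
    rw [← hQ, LinearMap.mem_ker, Matrix.mul_apply_eq_vecMul, hS, hB]
  -- Rewriting the generators of `ρ` through those of `π` and back changes them only by relations; U
  -- * S itself need not be the identity.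
  have h₂ : ∀ i, (1 - U * S : Matrix m m (Iwasawa p G)) i ∈ LinearMap.range (Matrix.toLinearMapRight' Q) := fun i => by
    have h : ρ ((U * S) i) = ρ ((1 : Matrix m m (Iwasawa p G)) i) := by
      rw [Matrix.mul_apply_eq_vecMul, hS, ← hU, ← Matrix.mul_apply_eq_vecMul, Matrix.one_mul]
    rw [← hQ, LinearMap.mem_ker]
    change ρ ((1 : Matrix m m (Iwasawa p G)) i - (U * S) i) = 0
    rw [map_sub, h, sub_self]
  obtain ⟨T₁, hT₁⟩ := exists_eq_mul_of_row_mem h₁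
  obtain ⟨T₂, hT₂⟩ := exists_eq_mul_of_row_mem h₂
  -- The off-diagonal entry vanishes by B S = T₁ Q, and the lower right one is 1 by U S + T₂ Q = 1.
  -- The block 1 is needed because B and Q may have different sizes.
  have key : Matrix.fromBlocks B 0 (-U) 1 =
      Matrix.fromBlocks B T₁ (-U) T₂ * Matrix.fromBlocks 1 (-S) 0 Q := by
    rw [Matrix.fromBlocks_multiply, ← hT₁, ← hT₂]
    congr 1 <;> simp
  -- The cofactor multiplies from the left, in accordance with `Ideal` meaning left ideal.
  refine Ideal.mem_span_singleton'.2 ⟨IwasawaNrd (Matrix.fromBlocks B T₁ (-U) T₂), ?_⟩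
  have h := congrArg IwasawaNrd key
  rw [IwasawaNrd_mul, IwasawaNrd_fromBlocks_zero₁₂, IwasawaNrd_fromBlocks_zero₂₁, IwasawaNrd_one,
    IwasawaNrd_one, mul_one, one_mul] at h
  exact h.symm

/-- The Fitting invariant of a module with a presentation by a square matrix `Q` is generated by
the reduced norm of `Q`. -/
theorem fittingInvariant_eq_span {N : Type*} [AddCommGroup N] [Module (Iwasawa p G) N]
    {ρ : (m → Iwasawa p G) →ₗ[Iwasawa p G] N} (hρ : Function.Surjective ρ)
    {Q : Matrix m m (Iwasawa p G)}
    (hQ : LinearMap.ker ρ = LinearMap.range (Matrix.toLinearMapRight' Q)) :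
    fittingInvariant p G N = Ideal.span {IwasawaNrd Q} := by
  refine le_antisymm (Ideal.span_le.2 ?_) (Ideal.span_le.2 ?_)
  · rintro _ ⟨a, b, h, ⟨π, hπ, hker⟩, r, rfl⟩
    refine IwasawaNrd_mem_span_of_relations hπ hρ hQ fun i => ?_
    -- A row of `h` is the image of a basis vector, hence a relation.
    have : h (r i) ∈ LinearMap.ker π := by
      rw [hker]
      exact ⟨Pi.single (r i) 1, by rw [Matrix.toLinearMapRight'_apply,
        Matrix.single_one_vecMul]; rfl⟩
    exact this
  · rw [Set.singleton_subset_iff]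
    -- Presentations are indexed by `Fin`, so `Q` is transported along `f`; the submatrix taken is
    -- the whole matrix.
    let f := Fintype.equivFin m
    let e := LinearEquiv.funCongrLeft (Iwasawa p G) (Iwasawa p G) f
    refine Ideal.subset_span ⟨Fintype.card m, Fintype.card m, Q.submatrix f.symm f.symm,
      ⟨ρ ∘ₗ e.toLinearMap, hρ.comp e.surjective, ?_⟩, RelEmbedding.refl _,
      (IwasawaNrd_reindex f Q).symm⟩
    have he : ∀ x : Fin (Fintype.card m) → Iwasawa p G,
        e (Matrix.toLinearMapRight' (Q.submatrix f.symm f.symm) x) =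
          Matrix.toLinearMapRight' Q (e x) := by
      intro x
      ext1 j
      rw [Matrix.toLinearMapRight'_apply, Matrix.toLinearMapRight'_apply]
      simp only [e, LinearEquiv.funCongrLeft_apply, LinearMap.funLeft_apply, Matrix.vecMul,
        dotProduct, Matrix.submatrix_apply, Equiv.symm_apply_apply]
      exact (Fintype.sum_equiv f _ _ fun i => by simp).symm
    ext x
    rw [LinearMap.mem_ker, LinearMap.comp_apply, ← LinearMap.mem_ker, hQ]
    constructor
    · rintro ⟨y, hy⟩
      refine ⟨e.symm y, e.injective ?_⟩
      rw [he, e.apply_symm_apply, hy]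
      rfl
    · rintro ⟨y, rfl⟩
      exact ⟨e y, (he y).symm⟩

end Fitting

/-! ### Compactness and inverse limits. -/

section InverseLimit

/-- In an inverse sequence of compact Hausdorff spaces, nonempty closed subsets which are mapped
into each other contain a compatible family. -/
theorem exists_compatible_of_isClosed {M : ℕ → Type*} [∀ n, TopologicalSpace (M n)]
    [∀ n, CompactSpace (M n)] [∀ n, T2Space (M n)]
    (t : ∀ {m n : ℕ}, m ≤ n → M n → M m) (ht : ∀ {m n : ℕ} (h : m ≤ n), Continuous (t h))
    (t_comp : ∀ {l m n : ℕ} (h : l ≤ m) (h' : m ≤ n) x, t h (t h' x) = t (h.trans h') x)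
    (S : ∀ n, Set (M n)) (hS : ∀ n, IsClosed (S n)) (hne : ∀ n, (S n).Nonempty)
    (hmap : ∀ {m n : ℕ} (h : m ≤ n), ∀ x ∈ S n, t h x ∈ S m) :
    ∃ y : ∀ n, M n, (∀ n, y n ∈ S n) ∧ ∀ m n (h : m ≤ n), t h (y n) = y m := by
  -- Compatibility is imposed only up to level N: these sets decrease with N, and each is visibly
  -- nonempty.
  let C : ℕ → Set (∀ n, M n) := fun N =>
    {y | (∀ n, y n ∈ S n) ∧ ∀ m n (h : m ≤ n), n ≤ N → t h (y n) = y m}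
  have hCc : ∀ N, IsClosed (C N) := by
    intro N
    have h : C N = (⋂ n, {y | y n ∈ S n}) ∩
        ⋂ (m) (n) (h : m ≤ n) (_ : n ≤ N), {y | t h (y n) = y m} := by
      ext y
      simp [C]
    rw [h]
    refine (isClosed_iInter fun n => (hS n).preimage (continuous_apply n)).inter
      (isClosed_iInter fun m => isClosed_iInter fun n => isClosed_iInter fun h =>
        isClosed_iInter fun _ => isClosed_eq ((ht h).comp (continuous_apply n))
          (continuous_apply m))
  have hCne : ∀ N, (C N).Nonempty := by
    intro N
    choose s hs using hne
    classical
    -- One point of level N is pushed down to all levels n ≤ N. Since `t le_rfl` is not assumed to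
    -- be the identity, level N itself also receives an image instead of `s N`.
    refine ⟨fun n => if h : n ≤ N then t h (t le_rfl (s N)) else s n, fun n => ?_,
      fun m n h hn => ?_⟩
    · by_cases h : n ≤ N
      · simpa [h] using hmap h _ (hmap le_rfl _ (hs N))
      · simpa [h] using hs n
    · simp only [hn, h.trans hn, dite_true]
      exact t_comp _ _ _
  obtain ⟨y, hy⟩ := IsCompact.nonempty_iInter_of_sequence_nonempty_isCompact_isClosed C
    (fun N y hy => ⟨hy.1, fun m n h hn => hy.2 m n h (hn.trans N.le_succ)⟩) hCne
    (hCc 0).isCompact hCc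
  rw [Set.mem_iInter] at hy
  exact ⟨y, (hy 0).1, fun m n h => (hy n).2 m n h le_rfl⟩

/-- Over a compact Noetherian ring, passing to the limit of an inverse sequence preserves
surjectivity of maps whose sources are finite free modules. -/
theorem exists_compatible_preimage {k : Type*} [CommRing k] [TopologicalSpace k]
    [IsTopologicalRing k] [CompactSpace k] [T2Space k] [IsNoetherianRing k]
    {M N : ℕ → Type*} [∀ n, AddCommGroup (M n)] [∀ n, Module k (M n)]
    [∀ n, Module.Free k (M n)] [∀ n, Module.Finite k (M n)]
    [∀ n, AddCommGroup (N n)] [∀ n, Module k (N n)]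
    (t : ∀ {m n : ℕ}, m ≤ n → M n →ₗ[k] M m)
    (t_comp : ∀ {l m n : ℕ} (h : l ≤ m) (h' : m ≤ n) x, t h (t h' x) = t (h.trans h') x)
    (u : ∀ {m n : ℕ}, m ≤ n → N n → N m) (φ : ∀ n, M n →ₗ[k] N n)
    (hφ : ∀ {m n : ℕ} (h : m ≤ n) x, φ m (t h x) = u h (φ n x))
    (x : ∀ n, N n) (hx : ∀ m n (h : m ≤ n), u h (x n) = x m)
    (hmem : ∀ n, ∃ y, φ n y = x n) :
    ∃ y : ∀ n, M n, (∀ n, φ n (y n) = x n) ∧ ∀ m n (h : m ≤ n), t h (y n) = y m := by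
  -- The module topology makes all linear maps between the `M n` continuous; coordinates in a basis
  -- give that `M n` is compact and Hausdorff.
  let τ : ∀ n, TopologicalSpace (M n) := fun n => moduleTopology k (M n)
  have hτ : ∀ n, IsModuleTopology k (M n) := fun n => ⟨rfl⟩
  have hadd : ∀ n, ContinuousAdd (M n) := fun n => IsModuleTopology.toContinuousAdd k (M n)
  have hT2 : ∀ n, T2Space (M n) := by
    intro n
    let e := (Module.Free.chooseBasis k (M n)).equivFun
    exact T2Space.of_injective_continuous e.injective
      (IsModuleTopology.continuous_of_linearMap e.toLinearMap)
  have hcpt : ∀ n, CompactSpace (M n) := by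
    intro n
    let e := (Module.Free.chooseBasis k (M n)).equivFun
    exact e.symm.surjective.compactSpace
      (IsModuleTopology.continuous_of_linearMap e.symm.toLinearMap)
  refine exists_compatible_of_isClosed (fun h => t h)
    (fun h => IsModuleTopology.continuous_of_linearMap (t h)) t_comp (fun n => {y | φ n y = x n})
    (fun n => ?_) hmem fun h y hy => ?_
  · obtain ⟨y₀, hy₀⟩ := hmem n
    -- No topology on `N n` is available to make the fibre closed. Instead, the kernel is finitely
    -- generated because k is Noetherian, so the fibre is a translate of a continuous image of the
    -- compact space k^r.
    obtain ⟨r, f, hf⟩ := Module.Finite.exists_fin' k (LinearMap.ker (φ n))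
    have himg : {y | φ n y = x n} = Set.range fun c => y₀ + (LinearMap.ker (φ n)).subtype (f c) := by
      ext y
      constructor
      · intro hy
        obtain ⟨c, hc⟩ := hf ⟨y - y₀, by
          rw [LinearMap.mem_ker, map_sub, hy₀, sub_eq_zero]; exact hy⟩
        exact ⟨c, by simp [hc]⟩
      · rintro ⟨c, rfl⟩
        have := (f c).2
        rw [LinearMap.mem_ker] at this
        simp [hy₀]
    rw [himg]
    refine (isCompact_range (continuous_const.add ?_)).isClosed
    exact IsModuleTopology.continuous_of_linearMap ((LinearMap.ker (φ n)).subtype ∘ₗ f)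
  · change φ _ (t h y) = _
    rw [hφ, show φ _ y = _ from hy, hx]

end InverseLimit

/-! ### The presentation of Pic of a derived graph over the group ring. -/

namespace Multigraph

variable {V E : Type*} (X : Multigraph V E) (k : Type*) [CommRing k] {H : Type*} [Group H]
  (α : E → H)

theorem picMk_firing (v : V) (g : H) :
    (X.derived α).picMk k ((X.derived α).firing k (v, g)) = 0 :=
  (Submodule.Quotient.mk_eq_zero _).2 (Submodule.subset_span ⟨(v, g), rfl⟩)

theorem single_smul_picMk [Finite E] (h : H) (r : k) (v : V) (g : H) :
    (MonoidAlgebra.single h r : MonoidAlgebra k H) •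
        (X.derived α).picMk k (Finsupp.single (v, g) 1) =
      r • (X.derived α).picMk k (Finsupp.single (v, h * g) 1) := by
  change (X.picRep k α).asAlgebraHom (MonoidAlgebra.single h r) _ = _
  rw [Representation.asAlgebraHom_single]
  exact congrArg (r • ·)
    (X.picMap_mk k (fun g => h * g) (fun g e => (mul_assoc h g (α e)).symm) v g)

variable [Fintype E]

/-- The surjection `k[H]^V → Pic` for a derived graph, sending the basis vector at `v` to the class
of the vertex `(v, 1)`. -/
noncomputable def picPres [Fintype V] : (V → MonoidAlgebra k H) →ₗ[MonoidAlgebra k H] (X.derived α).Pic k :=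
  Fintype.linearCombination (MonoidAlgebra k H)
    fun v => (X.derived α).picMk k (Finsupp.single (v, 1) 1)

theorem picPres_apply [Fintype V] (x : V → MonoidAlgebra k H) :
    X.picPres k α x = ∑ v, x v • (X.derived α).picMk k (Finsupp.single (v, 1) 1) := rfl

/-- The given k-action on Pic agrees with the one through k ⊆ k[H]; this allows `picPres` to be used
as a k-linear map. -/
theorem smul_picPres [Fintype V] (r : k) (x : V → MonoidAlgebra k H) :
    X.picPres k α (r • x) = r • X.picPres k α x := by
  have h : r • x = algebraMap k (MonoidAlgebra k H) r • x := (algebraMap_smul _ r x).symm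
  rw [h, map_smul]
  change (X.picRep k α).asAlgebraHom (algebraMap k _ r) _ = _
  rw [AlgHom.commutes]
  rfl

variable [DecidableEq V]

/-- The matrix `D - A_α` over the group ring of the voltage group. -/
noncomputable def voltageLaplacian : Matrix V V (MonoidAlgebra k H) :=
  Matrix.diagonal (fun v => ((Finset.univ.filter fun d => X.dirSrc d = v).card :
      MonoidAlgebra k H)) -
    Matrix.of fun v w => ∑ d with X.dirSrc d = v ∧ X.dirTgt d = w,
      MonoidAlgebra.of k H (dirVolt α d)

/-- Writes the row as a sum over directed edges, the form in which it can be compared term by term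
with a firing divisor. A loop contributes two terms. -/
theorem voltageLaplacian_row (v : V) :
    X.voltageLaplacian k α v = ∑ d with X.dirSrc d = v,
      (Pi.single v 1 - Pi.single (X.dirTgt d) (MonoidAlgebra.of k H (dirVolt α d))) := by
  ext1 w
  rw [Finset.sum_apply]
  simp only [voltageLaplacian, Matrix.sub_apply, Matrix.of_apply, Pi.sub_apply,
    Finset.sum_sub_distrib, Finset.sum_const]
  congr 1
  · by_cases h : w = v
    · subst h; simp
    · simp [h, Matrix.diagonal_apply_ne' _ h]
  · rw [← Finset.filter_filter, Finset.sum_filter]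
    exact Finset.sum_congr rfl fun d _ => by rw [Pi.single_apply]; simp [eq_comm]

theorem firing_derived_eq_sum (v : V) (g : H) :
    (X.derived α).firing k (v, g) = ∑ d with X.dirSrc d = v,
      (Finsupp.single (v, g) 1 - Finsupp.single (X.dirTgt d, g * dirVolt α d) 1) := by
  rw [firing_derived]
  refine finsum_mem_eq_sum_of_inter_support_eq _ ?_
  simp

variable [Fintype V]

theorem picPres_single (v : V) (g : H) (r : k) :
    X.picPres k α (Pi.single v (MonoidAlgebra.single g r)) =
      r • (X.derived α).picMk k (Finsupp.single (v, g) 1) := by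
  rw [picPres, Fintype.linearCombination_apply_single, single_smul_picMk, mul_one]

theorem picPres_laplacian_row (v : V) : X.picPres k α (X.voltageLaplacian k α v) = 0 := by
  rw [voltageLaplacian_row, ← picMk_firing X k α v 1, firing_derived_eq_sum, map_sum, map_sum]
  refine Finset.sum_congr rfl fun d _ => ?_
  rw [map_sub, map_sub, MonoidAlgebra.one_def, MonoidAlgebra.of_apply, picPres_single,
    picPres_single, one_smul, one_smul, one_mul]

theorem picPres_surjective : Function.Surjective (X.picPres k α) := by
  let f : (V → MonoidAlgebra k H) →ₗ[k] (X.derived α).Pic k :=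
    { toFun := X.picPres k α, map_add' := map_add _, map_smul' := X.smul_picPres k α }
  intro y
  suffices h : y ∈ LinearMap.range f from h
  obtain ⟨y, rfl⟩ := Submodule.mkQ_surjective _ y
  induction y using Finsupp.induction_linear with
  | zero => rw [map_zero]; exact zero_mem _
  | add a b ha hb => rw [map_add]; exact add_mem ha hb
  | single a r =>
    refine ⟨Pi.single a.1 (MonoidAlgebra.single a.2 r), ?_⟩
    change X.picPres k α _ = _
    rw [picPres_single, ← map_smul, Finsupp.smul_single, smul_eq_mul, mul_one]
    rfl

/-- The rows die in Pic, being firings at the vertices (v, 1). Conversely, a map from Pic back to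
k[H]^V modulo the rows shows that nothing else dies. -/
theorem ker_picPres : LinearMap.ker (X.picPres k α) =
    LinearMap.range (Matrix.toLinearMapRight' (X.voltageLaplacian k α)) := by
  refine le_antisymm ?_ ?_
  · set R := LinearMap.range (Matrix.toLinearMapRight' (X.voltageLaplacian k α))
    -- The candidate inverse sends (v, g) to the class of g e_v; it is defined on divisors and has
    -- to kill the principal ones.
    let σ₀ : (V × H →₀ k) →ₗ[k] (V → MonoidAlgebra k H) ⧸ R :=
      Finsupp.linearCombination k fun a => R.mkQ (Pi.single a.1 (MonoidAlgebra.single a.2 1))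
    have hσ₀ : ∀ a, σ₀ (Finsupp.single a 1) =
        R.mkQ (Pi.single a.1 (MonoidAlgebra.single a.2 1)) := fun a => by
      rw [Finsupp.linearCombination_single, one_smul]
    have hrow : ∀ v, X.voltageLaplacian k α v ∈ R := fun v =>
      ⟨Pi.single v 1, by rw [Matrix.toLinearMapRight'_apply, Matrix.single_one_vecMul]; rfl⟩
    have hker : (X.derived α).principal k ≤ LinearMap.ker σ₀ := by
      refine Submodule.span_le.2 ?_
      rintro _ ⟨⟨v, g⟩, rfl⟩
      -- The neighbour (w, g α(d)) goes to g α(d) e_w, so g factors out on the left.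
      have h : σ₀ ((X.derived α).firing k (v, g)) =
          R.mkQ (MonoidAlgebra.single g (1 : k) • X.voltageLaplacian k α v) := by
        rw [firing_derived_eq_sum, voltageLaplacian_row, map_sum, Finset.smul_sum, map_sum]
        refine Finset.sum_congr rfl fun d _ => ?_
        rw [map_sub, hσ₀, hσ₀, smul_sub, map_sub, ← Pi.single_smul, ← Pi.single_smul]
        simp
      rw [SetLike.mem_coe, LinearMap.mem_ker, h]
      exact (Submodule.Quotient.mk_eq_zero _).2 (Submodule.smul_mem _ _ (hrow v))
    let σ : (X.derived α).Pic k →ₗ[k] (V → MonoidAlgebra k H) ⧸ R :=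
      ((X.derived α).principal k).liftQ σ₀ hker
    -- A vector killed by `picPres` is therefore zero modulo the rows. By additivity it suffices to
    -- test multiples of the g e_v.
    have hσ : ∀ x, σ (X.picPres k α x) = R.mkQ x := by
      intro x
      induction x using Pi.single_induction with
      | zero => simp
      | add a b ha hb => rw [map_add, map_add, ha, hb, map_add]
      | single v a =>
        induction a using MonoidAlgebra.induction_linear with
        | zero => simp
        | add a b ha hb => rw [Pi.single_add, map_add, map_add, ha, hb, map_add]
        | single g r =>
          rw [picPres_single, map_smul]
          change r • σ₀ (Finsupp.single (v, g) 1) = _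
          rw [hσ₀]
          have h : (Pi.single v (MonoidAlgebra.single g r) : V → MonoidAlgebra k H) =
              r • Pi.single v (MonoidAlgebra.single g 1) := by
            rw [← Pi.single_smul]; simp
          rw [h]
          rfl
    intro x hx
    rw [LinearMap.mem_ker] at hx
    have := hσ x
    rw [hx, map_zero] at this
    exact (Submodule.Quotient.mk_eq_zero _).1 this.symm
  · rintro _ ⟨x, rfl⟩
    rw [LinearMap.mem_ker, Matrix.toLinearMapRight'_apply, Matrix.vecMul_eq_sum, map_sum]
    exact Finset.sum_eq_zero fun v _ => by
      rw [map_smul, picPres_laplacian_row, smul_zero]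

end Multigraph

/-! ### Passage to the limit over the layers. -/

section PicLim

theorem layerMap_comp (p : ℕ) {G : Type*} [Group G] [TopologicalSpace G] [IsTopologicalGroup G]
    {l m n : ℕ} (h : l ≤ m) (h' : m ≤ n) :
    (layerMap p G h).comp (layerMap p G h') = layerMap p G (h.trans h') :=
  QuotientGroup.map_comp_map _ _ _ (MonoidHom.id G) (MonoidHom.id G) (powSubgroup_anti p G h')
    (powSubgroup_anti p G h) (powSubgroup_anti p G (h.trans h'))

variable {V E : Type*} (X : Multigraph V E) (p : ℕ) [Fact p.Prime]
  {G : Type*} [Group G] [TopologicalSpace G] [IsTopologicalGroup G] (α : E → G)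

/-- The transition map on vectors over the group rings. -/
noncomputable def layerVecMap {m n : ℕ} (h : m ≤ n) :
    (V → MonoidAlgebra ℤ_[p] (Layer p G n)) →ₗ[ℤ_[p]] (V → MonoidAlgebra ℤ_[p] (Layer p G m)) :=
  (MonoidAlgebra.mapDomainAlgHom ℤ_[p] ℤ_[p] (layerMap p G h)).toLinearMap.compLeft V

theorem layerVecMap_apply {m n : ℕ} (h : m ≤ n) (x : V → MonoidAlgebra ℤ_[p] (Layer p G n))
    (v : V) : layerVecMap p h x v =
      MonoidAlgebra.mapDomainRingHom ℤ_[p] (layerMap p G h) (x v) := rfl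

theorem mapDomainRingHom_layerMap {l m n : ℕ} (h : l ≤ m) (h' : m ≤ n)
    (x : MonoidAlgebra ℤ_[p] (Layer p G n)) :
    MonoidAlgebra.mapDomainRingHom ℤ_[p] (layerMap p G h)
        (MonoidAlgebra.mapDomainRingHom ℤ_[p] (layerMap p G h') x) =
      MonoidAlgebra.mapDomainRingHom ℤ_[p] (layerMap p G (h.trans h')) x := by
  rw [← layerMap_comp p h h', MonoidAlgebra.mapDomainRingHom_comp, RingHom.comp_apply]

theorem layerVecMap_comp {l m n : ℕ} (h : l ≤ m) (h' : m ≤ n)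
    (x : V → MonoidAlgebra ℤ_[p] (Layer p G n)) :
    layerVecMap p h (layerVecMap p h' x) = layerVecMap p (h.trans h') x :=
  funext fun v => mapDomainRingHom_layerMap p h h' (x v)

/-- A compatible system of vectors over the group rings is a vector over `Λ`. -/
noncomputable def Iwasawa.vecOfCompatible (y : ∀ n, V → MonoidAlgebra ℤ_[p] (Layer p G n))
    (hy : ∀ m n (h : m ≤ n), layerVecMap p h (y n) = y m) : V → Iwasawa p G :=
  fun v => ⟨fun n => y n v, fun m n h => congrFun (hy m n h) v⟩

theorem vecMul_map_proj [Fintype V] (x : V → Iwasawa p G) (M : Matrix V V (Iwasawa p G)) (n : ℕ) :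
    (fun v => Iwasawa.proj n (Matrix.vecMul x M v)) =
      Matrix.vecMul (fun v => Iwasawa.proj n (x v)) (M.map (Iwasawa.proj n)) :=
  funext fun v => RingHom.map_vecMul (Iwasawa.proj n) M x v

/-- Makes the finite-level presentation apply to the reductions of D - A_α: degrees are integers,
and reduction modulo G^{p^n} respects inverses, hence the voltages of reversed edges. -/
theorem laplacian_map_proj [DecidableEq V] [Fintype E] (n : ℕ) :
    (degreeMatrix X p - voltageMatrix X p α).map (Iwasawa.proj n) =
      X.voltageLaplacian ℤ_[p] fun e => (QuotientGroup.mk (α e) : Layer p G n) := by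
  have hof : ∀ g : G, Iwasawa.proj n (Iwasawa.of g) =
      MonoidAlgebra.of ℤ_[p] (Layer p G n) (QuotientGroup.mk g) := fun _ => rfl
  have hvolt : ∀ d : E × Bool, (QuotientGroup.mk (Multigraph.dirVolt α d) : Layer p G n) =
      Multigraph.dirVolt (fun e => (QuotientGroup.mk (α e) : Layer p G n)) d := by
    rintro ⟨e, _ | _⟩ <;> rfl
  ext1 v w
  simp only [Matrix.map_apply, Multigraph.voltageLaplacian, Matrix.sub_apply, degreeMatrix,
    voltageMatrix, Matrix.of_apply, map_sub, map_sum, hof, hvolt]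
  congr 1
  by_cases h : v = w
  · subst h; simp
  · simp [h]

variable [Fintype E]

/-- The class of the vertices `(v, 1)` in the limit of the Picard groups. -/
noncomputable def PicLim.vertex (v : V) : PicLim X p α :=
  ⟨fun n => (layerGraph X p α n).picMk ℤ_[p] (Finsupp.single (v, 1) 1), fun m n h => by
    change X.picMap _ _ _ _ = _
    rw [Multigraph.picMap_mk, map_one]⟩

variable [Fintype V]

/-- The presentation of the limit of the Picard groups. -/
noncomputable def PicLim.pres : (V → Iwasawa p G) →ₗ[Iwasawa p G] PicLim X p α :=
  Fintype.linearCombination (Iwasawa p G) (PicLim.vertex X p α)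

theorem PicLim.pres_apply (x : V → Iwasawa p G) (n : ℕ) :
    (PicLim.pres X p α x).1 n =
      X.picPres ℤ_[p] (fun e => (QuotientGroup.mk (α e) : Layer p G n))
        fun v => Iwasawa.proj n (x v) := by
  rw [PicLim.pres, Fintype.linearCombination_apply, Multigraph.picPres_apply,
    AddSubmonoidClass.coe_finsetSum, Finset.sum_apply]
  rfl

/-- The chosen generators (v, 1) are compatible along the tower, so the finite-level presentations
form an inverse system. -/
theorem layerPicMap_picPres {m n : ℕ} (h : m ≤ n) (x : V → MonoidAlgebra ℤ_[p] (Layer p G n)) :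
    X.picPres ℤ_[p] (fun e => (QuotientGroup.mk (α e) : Layer p G m)) (layerVecMap p h x) =
      layerPicMap X p α h
        (X.picPres ℤ_[p] (fun e => (QuotientGroup.mk (α e) : Layer p G n)) x) := by
  rw [Multigraph.picPres_apply, Multigraph.picPres_apply, map_sum]
  refine Finset.sum_congr rfl fun v _ => ?_
  rw [layerPicMap, Multigraph.picMap_smul, Multigraph.picMap_mk, map_one, layerVecMap_apply]

variable [DecidableEq V] [IsUniformProP p G]

/-- Preimages exist at every level and compactness makes them compatible. Uniformity enters through
the finiteness of the layers, by which the group rings are finite free over ℤ_p. -/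
theorem PicLim.pres_surjective : Function.Surjective (PicLim.pres X p α) := by
  intro x
  obtain ⟨y, hyx, hy⟩ := exists_compatible_preimage (k := ℤ_[p])
    (M := fun n => V → MonoidAlgebra ℤ_[p] (Layer p G n))
    (N := fun n => (layerGraph X p α n).Pic ℤ_[p])
    (fun h => layerVecMap p h) (fun h h' x => layerVecMap_comp p h h' x)
    (fun h => layerPicMap X p α h)
    (fun n =>
      { toFun := X.picPres ℤ_[p] fun e => (QuotientGroup.mk (α e) : Layer p G n)
        map_add' := map_add _
        map_smul' := X.smul_picPres ℤ_[p] _ })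
    (fun h x => layerPicMap_picPres X p α h x) x.1 x.2
    (fun n => X.picPres_surjective ℤ_[p] _ (x.1 n))
  refine ⟨Iwasawa.vecOfCompatible p y hy, Subtype.ext (funext fun n => ?_)⟩
  rw [PicLim.pres_apply]
  exact hyx n

theorem PicLim.ker_pres : LinearMap.ker (PicLim.pres X p α) =
    LinearMap.range (Matrix.toLinearMapRight' (degreeMatrix X p - voltageMatrix X p α)) := by
  set Q := degreeMatrix X p - voltageMatrix X p α with hQ
  -- Vanishing in the limit is tested levelwise, so being a relation means that y Q = x is solvable
  -- at each level, with solutions that may be unrelated to each other.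
  have hmem : ∀ x : V → Iwasawa p G, x ∈ LinearMap.ker (PicLim.pres X p α) ↔ ∀ n,
      ∃ y, Matrix.vecMul y (Q.map (Iwasawa.proj n)) = fun v => Iwasawa.proj n (x v) := by
    intro x
    rw [LinearMap.mem_ker, ← Subtype.coe_inj, funext_iff]
    refine forall_congr' fun n => ?_
    rw [PicLim.pres_apply, hQ, laplacian_map_proj]
    change _ = 0 ↔ _
    rw [← LinearMap.mem_ker, Multigraph.ker_picPres]
    rfl
  ext x
  rw [hmem]
  constructor
  · intro hx
    -- The second use of compactness: the levelwise solutions are replaced by a compatible system,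
    -- which is a vector over Λ. The entries of `Q` being elements of Λ makes the multiplications by
    -- its reductions commute with the transition maps.
    obtain ⟨y, hyx, hy⟩ := exists_compatible_preimage (k := ℤ_[p])
      (M := fun n => V → MonoidAlgebra ℤ_[p] (Layer p G n))
      (N := fun n => V → MonoidAlgebra ℤ_[p] (Layer p G n))
      (fun h => layerVecMap p h) (fun h h' x => layerVecMap_comp p h h' x)
      (fun h => layerVecMap p h)
      (fun n => (Matrix.toLinearMapRight' (Q.map (Iwasawa.proj n))).restrictScalars ℤ_[p])
      (fun {m n} h x => by
        ext1 v
        change Matrix.vecMul (layerVecMap p h x) _ v =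
          MonoidAlgebra.mapDomainRingHom _ _ (Matrix.vecMul x _ v)
        rw [RingHom.map_vecMul]
        congr 1
        ext1 i j
        exact ((Q i j).2 m n h).symm)
      (fun n v => Iwasawa.proj n (x v)) (fun m n h => funext fun v => (x v).2 m n h) hx
    refine ⟨Iwasawa.vecOfCompatible p y hy, funext fun v => Subtype.ext (funext fun n => ?_)⟩
    have h := congrFun (vecMul_map_proj p (Iwasawa.vecOfCompatible p y hy) Q n) v
    exact h.trans (congrFun (hyx n) v)
  · rintro ⟨y, rfl⟩ n
    exact ⟨fun v => Iwasawa.proj n (y v), (vecMul_map_proj p y Q n).symm⟩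

end PicLim

/-- The Fitting invariant of the limit of the Picard groups is generated by the reduced norm of
`D - A_α`. The presentations of the `Pic(X_n)` stay exact in the limit by compactness of `ℤ_p`, so
the kernels of the Laplacians, which connectedness would determine, play no role. -/
theorem theorem1p1 (p : ℕ) [Fact p.Prime]
    (G : Type*) [Group G] [TopologicalSpace G] [IsTopologicalGroup G] [IsUniformProP p G]
    (V E : Type*) [Fintype V] [DecidableEq V] [Fintype E]
    (X : Multigraph V E) (α : E → G)
    (hconn : ∀ n : ℕ, (layerGraph X p α n).Connected) :
    fittingInvariant p G (PicLim X p α) =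
      Ideal.span {IwasawaNrd (degreeMatrix X p - voltageMatrix X p α)} :=
  fittingInvariant_eq_span (PicLim.pres_surjective X p α) (PicLim.ker_pres X p α)
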